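/- Let $X\subseteq\{1,\dots,k\}^{\mathbb N}$ be a nonempty one-sided subshift (closed, $\sigma(X)\subseteq X$ for the shift $\sigma$) with the weak specification property: there is $p\in\mathbb N$ such that for all words $u,v$ in the language $B(X)$ of $X$ there is $w\in B(X)$ of length at most $p$ with $uwv\in B(X)$. Let $M(X,\sigma)$ be the set of $\sigma$-invariant Borel probability measures on $X$, let $h_m(\sigma)$ be the Kolmogorov–Sinai entropy of $m\in M(X,\sigma)$, let $[x_1\dots x_n]$ be the cylinder in $X$ of the first $n$ symbols of $x\in X$, and let $S_ng=\sum_{i=0}^{n-1}g\circ\sigma^i$. Let $f_n:X\to(0,\infty)$, $n\ge 1$, be continuous functions and $\mathcal F=\{\log f_n\}_{n=1}^\infty$. Terminology. For $C_n>0$ consider the condition $$e^{-C_n}f_n(x)f_m(\sigma^nx)\le f_{n+m}(x)\le e^{C_n}f_n(x)f_m(\sigma^nx)\qquad(x\in X,\ n,m\ge1).\tag{1}$$ $\mathcal F$ is almost additive if (1) holds with $C_n=C$ for a constant $C>0$, and weakly almost additive if (1) holds for some $C_n>0$ with $C_n/n\to0$. $\mathcal F$ has bounded variation if there is $M$ such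 that $f_n(x)/f_n(y)\le M$ whenever $n\ge1$ and $x,y\in X$ agree in their first $n$ symbols. A measure $\mu\in M(X,\sigma)$ is an equilibrium state for $\mathcal F$ if it attains $\sup_{m\in M(X,\sigma)}\{h_m(\sigma)+\lim_n\frac1n\int\log f_n\,dm\}$, and for a bounded Borel function $g$ if it attains $\sup_{m\in M(X,\sigma)}\{h_m(\sigma)+\int g\,dm\}$. It is an (invariant) weak Gibbs measure for $\mathcal F$ if there are $P\in\mathbb R$ and $D_n>0$ with $\frac1n\log D_n\to0$ such that $$\frac1{D_n}\le\frac{\mu[x_1\dots x_n]}{e^{-nP}f_n(x)}\le D_n\qquad(x\in X,\ n\ge1),$$ and a Gibbs measure for $\mathcal F$ if $D_n$ can be taken constant in $n$. It is (weak) Gibbs for $g$ if the same holds with $e^{(S_ng)(x)}$ in place of $f_n(x)$. Theorem. Suppose that for every $x\in X$ the lower and upper limits, as $n\to\infty$, of $\log\big(f_n(x)/f_{n-1}(\sigma x)\big)$ coincide in $[-\infty,\infty]$, and let $\hat f(x)=\lim_{n\to\infty}\log\big(f_n(x)/f_{n-1}(\sigma x)\big)$. (i) If $\mathcal F$ is almost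 additive, then $\hat f$ is a (real-valued) bounded Borel measurable function, $$\lim_{n\to\infty}\frac1n\|\log f_n-S_n\hat f\|_\infty=0,\quad\text{and}\quad\lim_{n\to\infty}\frac1n\int\log f_n\,dm=\int\hat f\,dm\ \text{ for every } m\in M(X,\sigma).\tag{2}$$ If, in addition, $\mathcal F$ has bounded variation, then there is a measure $\mu\in M(X,\sigma)$ that is the unique equilibrium state for $\mathcal F$ and the unique invariant Gibbs measure for $\mathcal F$, and $\mu$ is also the unique equilibrium state for $\hat f$ and the unique invariant Gibbs measure for $\hat f$. (ii) If $\mathcal F$ is weakly almost additive, then $\hat f$ is a (real-valued) bounded Borel measurable function satisfying (2). Every equilibrium state for $\mathcal F$ that is a Gibbs measure for $\mathcal F$ is an equilibrium state for $\hat f$ and an invariant weak Gibbs measure for $\hat f$. -/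

import Mathlib

open MeasureTheory Filter Topology

namespace NonadditiveGibbs

open SymbolicDynamics.FullShift

noncomputable section

/-! ## Subshifts

A one-sided subshift over `k` symbols is Mathlib's `Subshift (Fin k) ℕ`: a closed subset of
`ℕ → Fin k` (product of discrete topologies) mapped into itself by the shift. Coordinates are
numbered from `0`. All notions below live on the space `X.carrier`, with the subspace topology and
the induced σ-algebra, which is its Borel σ-algebra. -/

/-- The shift map `σ : X → X`, `(σ x) i = x (i + 1)`. -/
def sigma {k : ℕ} (X : Subshift (Fin k) ℕ) (x : X.carrier) : X.carrier :=
  ⟨shift 1 x.1, X.mapsTo 1 x.2⟩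

/-- The language of `X`: the finite words that appear in some point of `X`. -/
def language {k : ℕ} (X : Subshift (Fin k) ℕ) : Set (List (Fin k)) :=
  {w | ∃ x ∈ X.carrier, ∃ i : ℕ, ∀ j : Fin w.length, x (i + j) = w.get j}

/-- Weak specification: any two allowable words `u`, `v` can be joined by an allowable word `w` of
length at most `p` (with `p` not depending on `u`, `v`) so that `uwv` is allowable. -/
def HasWeakSpecification {k : ℕ} (X : Subshift (Fin k) ℕ) : Prop :=
  ∃ p : ℕ, ∀ u ∈ language X, ∀ v ∈ language X,
    ∃ w ∈ language X, w.length ≤ p ∧ u ++ w ++ v ∈ language X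

/-- The cylinder `[x₁ … xₙ]` of `X` given by the first `n` symbols of `x`. -/
def cyl {k : ℕ} (X : Subshift (Fin k) ℕ) (n : ℕ) (x : X.carrier) : Set X.carrier :=
  Subtype.val ⁻¹' cylinder (Finset.range n) x.1

/-- The set `M(X, σ)` of shift-invariant Borel probability measures on `X`. -/
def invariantMeasures {k : ℕ} (X : Subshift (Fin k) ℕ) : Set (Measure X.carrier) :=
  {m | IsProbabilityMeasure m ∧ MeasurePreserving (sigma X) m m}

/-! ## Measure-theoretic entropy -/

/-- Shannon entropy of the join of `ξ, T⁻¹ξ, …, T⁻⁽ⁿ⁻¹⁾ξ`, for the partition of `α` into the `r`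
(possibly empty) level sets of `ξ`. -/
def joinEntropy {α : Type*} [MeasurableSpace α] (T : α → α) (m : Measure α) {r : ℕ}
    (ξ : α → Fin r) (n : ℕ) : ℝ :=
  ∑ w : Fin n → Fin r, Real.negMulLog (m.real {x | ∀ i : Fin n, ξ (T^[i] x) = w i})

/-- Kolmogorov–Sinai entropy `h_m(T)`: the supremum over finite measurable partitions of the growth
rate of the entropy of their refinements. (For an invariant probability measure the upper limit is
a limit.) -/
def entropy {α : Type*} [MeasurableSpace α] (T : α → α) (m : Measure α) : EReal :=
  ⨆ (r : ℕ) (ξ : α → Fin r) (_ : Measurable ξ),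
    limsup (fun n : ℕ => ((joinEntropy T m ξ n / n : ℝ) : EReal)) atTop

/-! ## Sequences `{log f_n}`, `n ≥ 1`

A sequence is given by functions `f n : X → ℝ`, positive for `n ≥ 1`; the value `f 0` is never
used. -/

section Sequences

variable {k : ℕ} {X : Subshift (Fin k) ℕ}

/-- `e^{-C} f_n(x) f_m(σⁿ x) ≤ f_{n+m}(x) ≤ e^{C} f_n(x) f_m(σⁿ x)`. -/
def AdditiveUpTo (f : ℕ → X.carrier → ℝ) (C : ℝ) (n m : ℕ) (x : X.carrier) : Prop :=
  f (n + m) x ≤ Real.exp C * f n x * f m ((sigma X)^[n] x) ∧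
    Real.exp (-C) * f n x * f m ((sigma X)^[n] x) ≤ f (n + m) x

/-- Almost additive sequences. -/
def IsAlmostAdditive (f : ℕ → X.carrier → ℝ) : Prop :=
  ∃ C : ℝ, 0 < C ∧ ∀ n m : ℕ, 1 ≤ n → 1 ≤ m → ∀ x, AdditiveUpTo f C n m x

/-- Weakly almost additive sequences: the constant may depend on `n`, with `C_n / n → 0`. -/
def IsWeaklyAlmostAdditive (f : ℕ → X.carrier → ℝ) : Prop :=
  ∃ C : ℕ → ℝ, (∀ n, 1 ≤ n → 0 < C n) ∧ Tendsto (fun n : ℕ => C n / n) atTop (𝓝 0) ∧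
    ∀ n m : ℕ, 1 ≤ n → 1 ≤ m → ∀ x, AdditiveUpTo f (C n) n m x

/-- Bounded variation: `f_n(x) / f_n(y) ≤ M` whenever `x`, `y` agree in their first `n` symbols. -/
def HasBoundedVariation (f : ℕ → X.carrier → ℝ) : Prop :=
  ∃ M : ℝ, ∀ n, 1 ≤ n → ∀ x y : X.carrier, y ∈ cyl X n x → f n x / f n y ≤ M

/-- `liminf_n log (f_n(x) / f_{n-1}(σ x))`, in the extended reals (with `n` shifted by one). -/
def lowerRatio (f : ℕ → X.carrier → ℝ) (x : X.carrier) : EReal :=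
  liminf (fun n : ℕ => ((Real.log (f (n + 1) x / f n (sigma X x)) : ℝ) : EReal)) atTop

/-- `limsup_n log (f_n(x) / f_{n-1}(σ x))`, in the extended reals (with `n` shifted by one). -/
def upperRatio (f : ℕ → X.carrier → ℝ) (x : X.carrier) : EReal :=
  limsup (fun n : ℕ => ((Real.log (f (n + 1) x / f n (sigma X x)) : ℝ) : EReal)) atTop

/-- The function `f̂(x) = lim_n log (f_n(x) / f_{n-1}(σ x))`, for sequences whose lower and upper
limits above agree and are finite. -/
def hatF (f : ℕ → X.carrier → ℝ) (x : X.carrier) : ℝ := (upperRatio f x).toReal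

/-- The positive functions `e^{S_n g}`, where `S_n g = ∑_{i<n} g ∘ σⁱ`. -/
def expSum (g : X.carrier → ℝ) (n : ℕ) (x : X.carrier) : ℝ :=
  Real.exp (birkhoffSum (sigma X) g n x)

/-! ## Equilibrium states and Gibbs measures -/

/-- `lim_n (1/n) ∫ log f_n dm` (written as an upper limit in the extended reals; for a weakly
almost additive sequence and an invariant `m` the limit exists). -/
def energy (f : ℕ → X.carrier → ℝ) (m : Measure X.carrier) : EReal :=
  limsup (fun n : ℕ => (((1 / n : ℝ) * ∫ x, Real.log (f n x) ∂m : ℝ) : EReal)) atTop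

/-- The set of equilibrium states of the sequence `{log f_n}`. -/
def equilibriumStates (f : ℕ → X.carrier → ℝ) : Set (Measure X.carrier) :=
  {μ | μ ∈ invariantMeasures X ∧
    entropy (sigma X) μ + energy f μ =
      ⨆ m ∈ invariantMeasures X, (entropy (sigma X) m + energy f m)}

/-- The set of equilibrium states of a (bounded Borel) function `g`. -/
def equilibriumStatesFun (g : X.carrier → ℝ) : Set (Measure X.carrier) :=
  {μ | μ ∈ invariantMeasures X ∧
    entropy (sigma X) μ + ((∫ x, g x ∂μ : ℝ) : EReal) =
      ⨆ m ∈ invariantMeasures X, (entropy (sigma X) m + ((∫ x, g x ∂m : ℝ) : EReal))}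

/-- The set of invariant Gibbs measures of the sequence `{log f_n}`. Those of a function `g` are
`invariantGibbs (expSum g)`. -/
def invariantGibbs (f : ℕ → X.carrier → ℝ) : Set (Measure X.carrier) :=
  {μ | μ ∈ invariantMeasures X ∧ ∃ P C : ℝ, 0 < C ∧ ∀ n, 1 ≤ n → ∀ x,
    1 / C ≤ μ.real (cyl X n x) / (Real.exp (-n * P) * f n x) ∧
      μ.real (cyl X n x) / (Real.exp (-n * P) * f n x) ≤ C}

/-- The set of invariant weak Gibbs measures of the sequence `{log f_n}`. Those of a function `g`
are `invariantWeakGibbs (expSum g)`. -/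
def invariantWeakGibbs (f : ℕ → X.carrier → ℝ) : Set (Measure X.carrier) :=
  {μ | μ ∈ invariantMeasures X ∧ ∃ (P : ℝ) (C : ℕ → ℝ), (∀ n, 1 ≤ n → 0 < C n) ∧
    Tendsto (fun n : ℕ => (1 / n : ℝ) * Real.log (C n)) atTop (𝓝 0) ∧ ∀ n, 1 ≤ n → ∀ x,
    1 / C n ≤ μ.real (cyl X n x) / (Real.exp (-n * P) * f n x) ∧
      μ.real (cyl X n x) / (Real.exp (-n * P) * f n x) ≤ C n}

/-- The supremum norm `‖g‖_∞ ∈ [0, ∞]`. -/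
def supNorm (g : X.carrier → ℝ) : ENNReal := ⨆ x, ENNReal.ofReal |g x|

/-- `g` is a bounded Borel function, `‖log f_n - S_n g‖_∞ / n → 0`, and
`(1/n) ∫ log f_n dm → ∫ g dm` for every invariant `m`. -/
def IsBoundedBorelApprox (f : ℕ → X.carrier → ℝ) (g : X.carrier → ℝ) : Prop :=
  (∃ B : ℝ, ∀ x, |g x| ≤ B) ∧ Measurable g ∧
    Tendsto (fun n : ℕ => supNorm (fun x => Real.log (f n x) - birkhoffSum (sigma X) g n x) / n)
      atTop (𝓝 0) ∧
    ∀ m ∈ invariantMeasures X,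
      Tendsto (fun n : ℕ => (1 / n : ℝ) * ∫ x, Real.log (f n x) ∂m) atTop (𝓝 (∫ x, g x ∂m))

end Sequences

end

end NonadditiveGibbs

open NonadditiveGibbs

/-!
The comparison of `log f_n` with `S_n f̂` is a telescoping argument: `f_{n+m}(x) / f_m(σⁿ x)` is a
product of `n` consecutive ratios `f_{j+1} / f_j ∘ σ`, so its logarithm tends to `S_n f̂ (x)` as
`m → ∞`, while additivity keeps it within `C_n` of `log f_n(x)` for every `m`. Hence
`|log f_n - S_n f̂| ≤ C_n` pointwise (`abs_log_sub_birkhoffSum_le`). Everything about `f̂` alone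
follows: boundedness, measurability, the uniform and the integrated limit, the equality of the
equilibrium states of `f̂` and of the sequence, and the passage from Gibbs to (weak) Gibbs measures.

It remains to find, in the almost additive case with bounded variation, an invariant measure that
is the only equilibrium state and the only invariant Gibbs measure.

* Existence. By weak specification the partition function (the sum of `f_n` over words of length
  `n`) is multiplicative up to a bounded factor, hence is `e^{nP}` up to a bounded factor
  (`exists_partitionFn_bounds`). A weak-* limit of discrete measures weighted by `f_N` satisfies the
  Gibbs bounds (`exists_gibbsBounds`). For every Gibbs measure, invariant or not, cylinders are
  quasi-independent up to a bounded gap (`GibbsBounds.joint_le`, `GibbsBounds.le_joint`). This keeps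
  the Gibbs bounds when passing to a limit of Cesàro averages
  (`exists_invariant_gibbsBounds`), and it makes the invariant Gibbs measure `μ` ergodic
  (`GibbsBounds.ergodic`).
* Variational principle. The partition into first symbols is a generator, so the entropy `h` of an
  invariant measure `m` is the growth rate, and by Fekete's lemma the infimum, of `H_n(m) / n`,
  where `H_n` is the Shannon entropy of the partition into words of length `n`
  (`exists_entropy_eq`). If `μ` is Gibbs, the relative entropy of `m` with respect to `μ` on that
  partition is `n (P - ∫ f̂ dm) - H_n(m)` up to a bounded error (`exists_relEntropy_bound`). It is
  nonnegative, so `h + ∫ f̂ dm ≤ P`; it vanishes for `m = μ`, so every invariant Gibbs measure is an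
  equilibrium state.
* Uniqueness. If `m` is an equilibrium state, then `H_n(m) ≥ n h = n (P - ∫ f̂ dm)`, so its relative
  entropy with respect to `μ` stays bounded as `n → ∞`. This forces `m ≪ μ`
  (`absolutelyContinuous_of_relEntropy_le`), and ergodicity of `μ` gives `m = μ`.
-/

namespace NonadditiveGibbs

open SymbolicDynamics.FullShift

noncomputable section

/-! ### Words, cylinders and Borel sets of a subshift -/

section Words

variable {k : ℕ} {X : Subshift (Fin k) ℕ}

instance : CompactSpace X.carrier := isCompact_iff_compactSpace.mp X.isClosed.isCompact

/-- The word formed by the first `n` symbols of `x`. -/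
def pre (X : Subshift (Fin k) ℕ) (n : ℕ) (x : X.carrier) : Fin n → Fin k := fun i => x.1 i

lemma sigma_iterate_apply (n : ℕ) (x : X.carrier) (i : ℕ) :
    ((sigma X)^[n] x).1 i = x.1 (n + i) := by
  induction n generalizing x with
  | zero => simp
  | succ n ih =>
    rw [Function.iterate_succ_apply, ih]
    simp only [sigma, shift_apply]
    exact congrArg x.1 (by omega)

lemma continuous_sigma : Continuous (sigma X) :=
  Continuous.subtype_mk ((continuous_shift 1).comp continuous_subtype_val) _

lemma measurable_sigma : Measurable (sigma X) := continuous_sigma.measurable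

lemma continuous_pre (n : ℕ) : Continuous (pre X n) := by
  refine continuous_pi fun i => ?_
  exact (continuous_apply (i : ℕ)).comp continuous_subtype_val

lemma measurable_pre (n : ℕ) : Measurable (pre X n) := (continuous_pre n).measurable

lemma isClopen_pre (n : ℕ) (S : Set (Fin n → Fin k)) : IsClopen (pre X n ⁻¹' S) :=
  (isClopen_discrete S).preimage (continuous_pre n)

lemma pre_eq_iff {n : ℕ} {x y : X.carrier} :
    pre X n x = pre X n y ↔ ∀ i < n, x.1 i = y.1 i := by
  simp [pre, funext_iff, Fin.forall_iff]

lemma mem_cyl_iff {n : ℕ} {x y : X.carrier} : y ∈ cyl X n x ↔ pre X n y = pre X n x := by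
  simp [cyl, SymbolicDynamics.FullShift.mem_cylinder, pre_eq_iff]

lemma cyl_eq (n : ℕ) (x : X.carrier) : cyl X n x = pre X n ⁻¹' {pre X n x} := by
  ext y
  simp [mem_cyl_iff]

lemma pre_eq_of_le {m n : ℕ} (h : m ≤ n) {x y : X.carrier} (hxy : pre X n x = pre X n y) :
    pre X m x = pre X m y := by
  rw [pre_eq_iff] at *
  exact fun i hi => hxy i (hi.trans_le h)

lemma pre_sigma_eq {m n : ℕ} {x y : X.carrier} (hxy : pre X (n + m) x = pre X (n + m) y) :
    pre X m ((sigma X)^[n] x) = pre X m ((sigma X)^[n] y) := by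
  rw [pre_eq_iff] at *
  intro i hi
  rw [sigma_iterate_apply, sigma_iterate_apply]
  exact hxy _ (by omega)

lemma pre_add_eq {m n : ℕ} {x y : X.carrier} (h1 : pre X n x = pre X n y)
    (h2 : pre X m ((sigma X)^[n] x) = pre X m ((sigma X)^[n] y)) :
    pre X (n + m) x = pre X (n + m) y := by
  rw [pre_eq_iff] at *
  intro i hi
  rcases lt_or_ge i n with h | h
  · exact h1 i h
  · have := h2 (i - n) (by omega)
    rw [sigma_iterate_apply, sigma_iterate_apply] at this
    simpa [Nat.add_sub_cancel' h] using this

/-- Weak specification in terms of points, with gaps of length at most `p`: the first `n` symbols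
of `x` and the first `m` symbols of `y` occur in one point `z`, which starts with the former and
continues with the latter after a gap of length `l ≤ p`. -/
def GlueWithin (X : Subshift (Fin k) ℕ) (p : ℕ) : Prop :=
  ∀ (n m : ℕ) (x y : X.carrier), ∃ l ≤ p, ∃ z : X.carrier,
    pre X n z = pre X n x ∧ pre X m ((sigma X)^[n + l] z) = pre X m y

lemma HasWeakSpecification.exists_glueWithin (hspec : HasWeakSpecification X) :
    ∃ p : ℕ, GlueWithin X p := by
  obtain ⟨p, hp⟩ := hspec
  refine ⟨p, fun n m x y => ?_⟩
  have hlang : ∀ (n : ℕ) (x : X.carrier), List.ofFn (pre X n x) ∈ language X := by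
    intro n x
    refine ⟨x.1, x.2, 0, fun j => ?_⟩
    simp [pre]
  obtain ⟨w, -, hw, z, hz, i, hzi⟩ := hp _ (hlang n x) _ (hlang m y)
  refine ⟨w.length, hw, (sigma X)^[i] ⟨z, hz⟩, ?_, ?_⟩
  · rw [pre_eq_iff]
    intro j hj
    rw [sigma_iterate_apply]
    have := hzi ⟨j, by simp; omega⟩
    simp only [List.get_eq_getElem] at this
    refine this.trans ?_
    rw [List.getElem_append_left (by simp; omega), List.getElem_append_left (by simpa)]
    simp [pre]
  · rw [pre_eq_iff]
    intro j hj
    rw [sigma_iterate_apply, sigma_iterate_apply]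
    have := hzi ⟨n + w.length + j, by simp; omega⟩
    simp only [List.get_eq_getElem] at this
    refine this.trans ?_
    rw [List.getElem_append_right (by simp)]
    simp [pre]

lemma measurableSpace_eq_generateFrom :
    (inferInstance : MeasurableSpace X.carrier) =
      MeasurableSpace.generateFrom
        {A | ∃ (n : ℕ) (S : Set (Fin n → Fin k)), A = pre X n ⁻¹' S} := by
  apply le_antisymm
  · change MeasurableSpace.comap _ _ ≤ _
    rw [MeasurableSpace.comap_le_iff_le_map, MeasurableSpace.pi]
    refine iSup_le fun i => ?_
    rw [MeasurableSpace.comap_le_iff_le_map]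
    intro s _
    refine MeasurableSpace.measurableSet_generateFrom ⟨i + 1, {w | w (Fin.last i) ∈ s}, ?_⟩
    ext x
    simp [pre]
  · refine MeasurableSpace.generateFrom_le ?_
    rintro A ⟨n, S, rfl⟩
    exact (isClopen_pre n S).isOpen.measurableSet

/-- Any finite union of cylinders can be written with cylinders of a larger length. -/
lemma exists_pre_preimage_eq {n N : ℕ} (h : n ≤ N) (S : Set (Fin n → Fin k)) :
    ∃ T : Set (Fin N → Fin k), pre X n ⁻¹' S = pre X N ⁻¹' T :=
  ⟨{w | (fun i : Fin n => w (Fin.castLE h i)) ∈ S}, by ext x; rfl⟩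

lemma isSetRing_cylinders :
    IsSetRing {A | ∃ (n : ℕ) (S : Set (Fin n → Fin k)), A = pre X n ⁻¹' S} where
  empty_mem := ⟨0, ∅, by simp⟩
  union_mem := by
    rintro _ _ ⟨n, S, rfl⟩ ⟨m, T, rfl⟩
    obtain ⟨S', hS⟩ := exists_pre_preimage_eq (X := X) (le_max_left n m) S
    obtain ⟨T', hT⟩ := exists_pre_preimage_eq (X := X) (le_max_right n m) T
    exact ⟨max n m, S' ∪ T', by rw [hS, hT, Set.preimage_union]⟩
  sdiff_mem := by
    rintro _ _ ⟨n, S, rfl⟩ ⟨m, T, rfl⟩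
    obtain ⟨S', hS⟩ := exists_pre_preimage_eq (X := X) (le_max_left n m) S
    obtain ⟨T', hT⟩ := exists_pre_preimage_eq (X := X) (le_max_right n m) T
    exact ⟨max n m, S' \ T', by rw [hS, hT, Set.preimage_sdiff]⟩

open scoped symmDiff in
/-- Borel sets are approximated in measure by finite unions of cylinders. -/
lemma exists_cylinder_approx (m : Measure X.carrier) [IsFiniteMeasure m] {E : Set X.carrier}
    (hE : MeasurableSet E) {ε : ℝ} (hε : 0 < ε) :
    ∃ (n : ℕ) (S : Set (Fin n → Fin k)), m.real ((pre X n ⁻¹' S) ∆ E) < ε := by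
  obtain ⟨_, ⟨n, S, rfl⟩, h⟩ := exists_measure_symmDiff_lt_of_generateFrom_isSetRing (μ := m)
    isSetRing_cylinders ⟨{Set.univ}, by simp, by
      rintro _ rfl
      exact ⟨0, Set.univ, by simp⟩, by simp⟩ measurableSpace_eq_generateFrom hE
    (ε := ENNReal.ofReal ε) (by simpa)
  exact ⟨n, S, by
    rw [measureReal_def]
    exact (ENNReal.lt_ofReal_iff_toReal_lt (measure_ne_top _ _)).mp h⟩

/-- Two probability measures that agree on finite unions of cylinders are equal. -/
lemma measure_ext_pre {m m' : Measure X.carrier} [IsProbabilityMeasure m] [IsProbabilityMeasure m']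
    (h : ∀ (n : ℕ) (S : Set (Fin n → Fin k)), m (pre X n ⁻¹' S) = m' (pre X n ⁻¹' S)) :
    m = m' := by
  refine ext_of_generate_finite _ measurableSpace_eq_generateFrom
    isSetRing_cylinders.isSetSemiring.isPiSystem ?_ (by simp)
  rintro _ ⟨n, S, rfl⟩
  exact h n S

end Words

/-! ### Laws of finite-valued maps -/

lemma measureReal_preimage_eq_sum {Ω ι : Type*} [MeasurableSpace Ω] [MeasurableSpace ι]
    [MeasurableSingletonClass ι] {m : Measure Ω} [IsFiniteMeasure m] {ξ : Ω → ι}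
    (hξ : Measurable ξ) (S : Finset ι) :
    m.real (ξ ⁻¹' S) = ∑ i ∈ S, m.real (ξ ⁻¹' {i}) :=
  (sum_measureReal_preimage_singleton S fun i _ => hξ (measurableSet_singleton i)).symm

lemma sum_joint {Ω ι κ : Type*} [MeasurableSpace Ω] [MeasurableSpace ι]
    [MeasurableSingletonClass ι] [MeasurableSpace κ] [MeasurableSingletonClass κ]
    {m : Measure Ω} [IsFiniteMeasure m] {ξ : Ω → ι} {η : Ω → κ} (hξ : Measurable ξ)
    (hη : Measurable η) (U : Finset ι) (V : Finset κ) :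
    ∑ i ∈ U, ∑ j ∈ V, m.real ((fun x => (ξ x, η x)) ⁻¹' {(i, j)}) =
      m.real (ξ ⁻¹' U ∩ η ⁻¹' V) := by
  rw [← Finset.sum_product', ← Set.mk_preimage_prod, ← Finset.coe_product,
    measureReal_preimage_eq_sum (hξ.prodMk hη)]

lemma sum_marginal_snd {Ω ι κ : Type*} [MeasurableSpace Ω] [Fintype ι] [MeasurableSpace ι]
    [MeasurableSingletonClass ι] [MeasurableSpace κ] [MeasurableSingletonClass κ]
    {m : Measure Ω} [IsFiniteMeasure m] {ξ : Ω → ι} {η : Ω → κ} (hξ : Measurable ξ)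
    (hη : Measurable η) (j : κ) :
    ∑ i, m.real ((fun x => (ξ x, η x)) ⁻¹' {(i, j)}) = m.real (η ⁻¹' {j}) := by
  simpa using sum_joint (m := m) hξ hη Finset.univ {j}

/-! ### Entropy of finite-valued random variables -/

section Shannon

variable {Ω : Type*} [MeasurableSpace Ω] {m : Measure Ω}
variable {ι κ τ : Type*} [Fintype ι] [Fintype κ] [Fintype τ]

/-- Shannon entropy of the partition of `Ω` into the level sets of `ξ`. -/
def shannon (m : Measure Ω) (ξ : Ω → ι) : ℝ := ∑ i, Real.negMulLog (m.real (ξ ⁻¹' {i}))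

/-- Conditional entropy of `ξ` given `η`, as a difference of entropies. -/
def condShannon (m : Measure Ω) (ξ : Ω → ι) (η : Ω → κ) : ℝ :=
  shannon m (fun x => (ξ x, η x)) - shannon m η

lemma shannon_nonneg [IsProbabilityMeasure m] (ξ : Ω → ι) : 0 ≤ shannon m ξ :=
  Finset.sum_nonneg fun _ _ => Real.negMulLog_nonneg measureReal_nonneg measureReal_le_one

variable [MeasurableSpace ι] [MeasurableSingletonClass ι]

/-- Entropy does not increase when the values are passed through a map. -/
lemma shannon_comp_le [IsProbabilityMeasure m] {ξ : Ω → ι} {η : Ω → κ} (hξ : Measurable ξ)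
    (g : ι → κ) (hg : ∀ x, η x = g (ξ x)) : shannon m η ≤ shannon m ξ := by
  classical
  have key : ∀ j, Real.negMulLog (m.real (η ⁻¹' {j})) ≤
      ∑ i with g i = j, Real.negMulLog (m.real (ξ ⁻¹' {i})) := by
    intro j
    have hj : m.real (η ⁻¹' {j}) = ∑ i with g i = j, m.real (ξ ⁻¹' {i}) := by
      rw [← measureReal_preimage_eq_sum hξ]
      congr 1
      ext x
      simp [hg]
    rw [Real.negMulLog, hj, ← Finset.sum_neg_distrib, Finset.sum_mul]
    refine Finset.sum_le_sum fun i hi => ?_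
    rw [Real.negMulLog]
    rcases (measureReal_nonneg (μ := m) (s := ξ ⁻¹' {i})).eq_or_lt with h0 | h0
    · simp [← h0]
    · have : Real.log (m.real (ξ ⁻¹' {i})) ≤
          Real.log (∑ i with g i = j, m.real (ξ ⁻¹' {i})) :=
        Real.log_le_log h0 (Finset.single_le_sum (f := fun i => m.real (ξ ⁻¹' {i}))
          (fun _ _ => measureReal_nonneg) hi)
      nlinarith
  calc shannon m η ≤ ∑ j, ∑ i with g i = j, Real.negMulLog (m.real (ξ ⁻¹' {i})) :=
        Finset.sum_le_sum fun j _ => key j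
    _ = shannon m ξ := Finset.sum_fiberwise _ g _

lemma shannon_comp_measurePreserving {T : Ω → Ω} (hT : MeasurePreserving T m m) {ξ : Ω → ι}
    (hξ : Measurable ξ) : shannon m (fun x => ξ (T x)) = shannon m ξ := by
  refine Finset.sum_congr rfl fun i _ => ?_
  congr 1
  exact hT.measureReal_preimage (hξ (measurableSet_singleton i)).nullMeasurableSet

variable [MeasurableSpace κ] [MeasurableSingletonClass κ]

lemma condShannon_comp_measurePreserving {T : Ω → Ω} (hT : MeasurePreserving T m m) {ξ : Ω → ι}
    {η : Ω → κ} (hξ : Measurable ξ) (hη : Measurable η) :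
    condShannon m (fun x => ξ (T x)) (fun x => η (T x)) = condShannon m ξ η := by
  rw [condShannon, condShannon, shannon_comp_measurePreserving hT hη,
    shannon_comp_measurePreserving hT (hξ.prodMk hη)]

lemma shannon_eq_of_comp [IsProbabilityMeasure m] {ξ : Ω → ι} {η : Ω → κ} (hξ : Measurable ξ)
    (hη : Measurable η) (g : ι → κ) (hg : ∀ x, η x = g (ξ x)) (h : κ → ι)
    (hh : ∀ x, ξ x = h (η x)) : shannon m η = shannon m ξ :=
  le_antisymm (shannon_comp_le hξ g hg) (shannon_comp_le hη h hh)

variable [MeasurableSpace τ] [MeasurableSingletonClass τ]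

/-- Strong subadditivity of entropy: conditioning on more decreases conditional entropy. -/
lemma condShannon_prod_le [IsProbabilityMeasure m] {ξ : Ω → ι} {η : Ω → κ} {ζ : Ω → τ}
    (hξ : Measurable ξ) (hη : Measurable η) (hζ : Measurable ζ) :
    condShannon m ξ (fun x => (η x, ζ x)) ≤ condShannon m ξ ζ := by
  set p : ι → κ × τ → ℝ := fun i b => m.real ((fun x => (ξ x, (η x, ζ x))) ⁻¹' {(i, b)}) with hp
  set q : κ × τ → ℝ := fun b => m.real ((fun x => (η x, ζ x)) ⁻¹' {b}) with hq
  set r : ι → τ → ℝ := fun i l => m.real ((fun x => (ξ x, ζ x)) ⁻¹' {(i, l)}) with hr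
  set s : τ → ℝ := fun l => m.real (ζ ⁻¹' {l}) with hs
  have hp0 : ∀ i b, 0 ≤ p i b := fun _ _ => measureReal_nonneg
  have hq0 : ∀ b, 0 ≤ q b := fun _ => measureReal_nonneg
  have hr0 : ∀ i l, 0 ≤ r i l := fun _ _ => measureReal_nonneg
  have hs0 : ∀ l, 0 ≤ s l := fun _ => measureReal_nonneg
  have hpq : ∀ b, ∑ i, p i b = q b := fun b => sum_marginal_snd hξ (hη.prodMk hζ) b
  have hpr : ∀ i l, ∑ j, p i (j, l) = r i l := by
    intro i l
    refine Eq.trans ?_ (sum_marginal_snd hη (hξ.prodMk hζ) (i, l))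
    refine Finset.sum_congr rfl fun j _ => ?_
    simp only [hp]
    congr 1
    ext x
    simp
    tauto
  have hqs : ∀ l, ∑ j, q (j, l) = s l := fun l => sum_marginal_snd hη hζ l
  have hrs : ∀ l, ∑ i, r i l = s l := fun l => sum_marginal_snd hξ hζ l
  have hpleq : ∀ i b, p i b ≤ q b := fun i b => by
    rw [← hpq]; exact Finset.single_le_sum (f := fun i => p i b) (fun i _ => hp0 i b) (by simp)
  have hpler : ∀ i j l, p i (j, l) ≤ r i l := fun i j l => by
    rw [← hpr]
    exact Finset.single_le_sum (f := fun j => p i (j, l)) (fun j _ => hp0 i (j, l)) (by simp)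
  have hqles : ∀ j l, q (j, l) ≤ s l := fun j l => by
    rw [← hqs]
    exact Finset.single_le_sum (f := fun j => q (j, l)) (fun j _ => hq0 (j, l)) (by simp)
  -- all four entropies are written as sums over the joint distribution
  have e1 : shannon m (fun x => (ξ x, (η x, ζ x))) =
      ∑ i, ∑ l, ∑ j, -(p i (j, l) * Real.log (p i (j, l))) := by
    rw [shannon, Fintype.sum_prod_type]
    refine Finset.sum_congr rfl fun i _ => ?_
    rw [Fintype.sum_prod_type, Finset.sum_comm]
    simp only [Real.negMulLog, neg_mul]
    rfl
  have e2 : shannon m (fun x => (η x, ζ x)) =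
      ∑ i, ∑ l, ∑ j, -(p i (j, l) * Real.log (q (j, l))) := by
    rw [shannon, Fintype.sum_prod_type, Finset.sum_comm,
      Finset.sum_comm (s := Finset.univ (α := ι))]
    refine Finset.sum_congr rfl fun l _ => ?_
    rw [Finset.sum_comm]
    refine Finset.sum_congr rfl fun j _ => ?_
    rw [Finset.sum_neg_distrib, ← Finset.sum_mul, hpq, Real.negMulLog, neg_mul]
  have e3 : shannon m (fun x => (ξ x, ζ x)) =
      ∑ i, ∑ l, ∑ j, -(p i (j, l) * Real.log (r i l)) := by
    rw [shannon, Fintype.sum_prod_type]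
    refine Finset.sum_congr rfl fun i _ => Finset.sum_congr rfl fun l _ => ?_
    rw [Finset.sum_neg_distrib, ← Finset.sum_mul, hpr, Real.negMulLog, neg_mul]
  have e4 : shannon m ζ = ∑ i, ∑ l, ∑ j, -(p i (j, l) * Real.log (s l)) := by
    rw [shannon, Finset.sum_comm]
    refine Finset.sum_congr rfl fun l _ => ?_
    simp_rw [Finset.sum_neg_distrib, ← Finset.sum_mul, hpr, hrs]
    rw [Real.negMulLog, neg_mul]
  -- `log t ≤ t - 1`, for the ratio `t` of the law that makes `ξ` and `η` independent given `ζ` to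
  -- the joint law
  have hterm : ∀ i l j, p i (j, l) - r i l * q (j, l) / s l ≤
      -(p i (j, l) * Real.log (q (j, l))) + -(p i (j, l) * Real.log (r i l))
      - -(p i (j, l) * Real.log (p i (j, l))) - -(p i (j, l) * Real.log (s l)) := by
    intro i l j
    rcases (hp0 i (j, l)).eq_or_lt with h0 | h0
    · rw [← h0]
      have : 0 ≤ r i l * q (j, l) / s l := by
        have := hr0 i l; have := hq0 (j, l); have := hs0 l; positivity
      simp
      linarith
    · have hq1 := h0.trans_le (hpleq i (j, l))
      have hr1 := h0.trans_le (hpler i j l)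
      have hs1 := hq1.trans_le (hqles j l)
      have := Real.log_le_sub_one_of_pos (x := r i l * q (j, l) / (s l * p i (j, l)))
        (by positivity)
      rw [Real.log_div (by positivity) (by positivity), Real.log_mul hr1.ne' hq1.ne',
        Real.log_mul hs1.ne' h0.ne'] at this
      have h2 := mul_le_mul_of_nonneg_left this h0.le
      have h3 : p i (j, l) * (r i l * q (j, l) / (s l * p i (j, l)) - 1) =
          r i l * q (j, l) / s l - p i (j, l) := by
        field_simp
      rw [h3] at h2
      linarith
  have hsum : ∑ i, ∑ l, ∑ j, (p i (j, l) - r i l * q (j, l) / s l) = 0 := by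
    have h1 : ∑ i, ∑ l, ∑ j, p i (j, l) = ∑ l, s l := by
      simp_rw [hpr]
      rw [Finset.sum_comm]
      simp_rw [hrs]
    have h2 : ∑ i, ∑ l, ∑ j, r i l * q (j, l) / s l = ∑ l, s l := by
      rw [Finset.sum_comm]
      refine Finset.sum_congr rfl fun l _ => ?_
      simp_rw [← Finset.sum_div, ← Finset.mul_sum, hqs, ← Finset.sum_mul, hrs]
      simp
    simp_rw [Finset.sum_sub_distrib]
    rw [h1, h2, sub_self]
  have := Finset.sum_le_sum fun i (_ : i ∈ Finset.univ) => Finset.sum_le_sum fun l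
    (_ : l ∈ Finset.univ) => Finset.sum_le_sum fun j (_ : j ∈ Finset.univ) => hterm i l j
  rw [hsum] at this
  simp_rw [Finset.sum_sub_distrib, Finset.sum_add_distrib] at this
  rw [← e1, ← e2, ← e3, ← e4] at this
  rw [condShannon, condShannon]
  linarith

lemma condShannon_le_of_comp [IsProbabilityMeasure m] {ξ : Ω → ι} {η : Ω → κ} {ζ : Ω → τ}
    (hξ : Measurable ξ) (hη : Measurable η) (hζ : Measurable ζ) (g : κ → τ)
    (hg : ∀ x, ζ x = g (η x)) : condShannon m ξ η ≤ condShannon m ξ ζ := by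
  refine le_trans (le_of_eq ?_) (condShannon_prod_le hξ hη hζ)
  rw [condShannon, condShannon]
  congr 1
  · exact shannon_eq_of_comp (hξ.prodMk (hη.prodMk hζ)) (hξ.prodMk hη) (fun a => (a.1, a.2.1))
      (fun _ => rfl) (fun a => (a.1, a.2, g a.2)) (fun x => by simp [hg])
  · exact shannon_eq_of_comp (hη.prodMk hζ) hη (fun a => a.1)
      (fun _ => rfl) (fun a => (a, g a)) (fun x => by simp [hg])

lemma shannon_prod_le [IsProbabilityMeasure m] {ξ : Ω → ι} {η : Ω → κ}
    (hξ : Measurable ξ) (hη : Measurable η) :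
    shannon m (fun x => (ξ x, η x)) ≤ shannon m ξ + shannon m η := by
  have h := condShannon_le_of_comp (m := m) (ζ := fun _ => ()) hξ hη measurable_const
    (fun _ => ()) (fun _ => rfl)
  have h1 : shannon m (fun _ : Ω => ()) = 0 := by simp [shannon]
  have h2 : shannon m (fun x => (ξ x, ())) = shannon m ξ :=
    shannon_eq_of_comp hξ (hξ.prodMk measurable_const) (fun a => (a, ())) (fun _ => rfl)
      (fun a => a.1) (fun _ => rfl)
  rw [condShannon, condShannon, h1, h2] at h
  linarith

/-- Conditional entropy is subadditive in its first argument. -/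
lemma condShannon_pair_le [IsProbabilityMeasure m] {ξ : Ω → ι} {η : Ω → κ} {ζ : Ω → τ}
    (hξ : Measurable ξ) (hη : Measurable η) (hζ : Measurable ζ) :
    condShannon m (fun x => (ξ x, η x)) ζ ≤ condShannon m ξ ζ + condShannon m η ζ := by
  have h := condShannon_prod_le (m := m) hξ hη hζ
  have h1 : shannon m (fun x => ((ξ x, η x), ζ x)) = shannon m (fun x => (ξ x, (η x, ζ x))) :=
    shannon_eq_of_comp (hξ.prodMk (hη.prodMk hζ)) ((hξ.prodMk hη).prodMk hζ)
      (fun a => ((a.1, a.2.1), a.2.2)) (fun _ => rfl) (fun a => (a.1.1, a.1.2, a.2)) (fun _ => rfl)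
  simp only [condShannon] at *
  linarith

lemma condShannon_tuple_le [IsProbabilityMeasure m] {ζ : Ω → τ} (hζ : Measurable ζ) (n : ℕ)
    (ξ : ℕ → Ω → ι) (hξ : ∀ i, Measurable (ξ i)) :
    condShannon m (fun x => fun i : Fin n => ξ i x) ζ ≤
      ∑ i ∈ Finset.range n, condShannon m (ξ i) ζ := by
  have hmeas : ∀ n, Measurable (fun x => fun i : Fin n => ξ i x) :=
    fun n => measurable_pi_lambda _ fun i => hξ i
  induction n with
  | zero =>
    refine le_of_eq ?_
    rw [condShannon, Finset.sum_range_zero, sub_eq_zero]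
    exact shannon_eq_of_comp hζ ((hmeas 0).prodMk hζ) (fun a => (fun i => i.elim0, a))
      (fun x => by simp; ext i; exact i.elim0) (fun a => a.2) (fun _ => rfl)
  | succ n ih =>
    rw [Finset.sum_range_succ]
    refine le_trans (le_trans (le_of_eq ?_)
      (condShannon_pair_le (hmeas n) (hξ n) hζ)) (add_le_add_left ih _)
    rw [condShannon, condShannon]
    congr 1
    exact shannon_eq_of_comp (((hmeas n).prodMk (hξ n)).prodMk hζ) ((hmeas (n + 1)).prodMk hζ)
      (fun a => (fun i => if h : (i : ℕ) < n then a.1.1 ⟨i, h⟩ else a.1.2, a.2))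
      (fun x => by
        simp only [Prod.mk.injEq, and_true]
        ext i
        split_ifs with h
        · rfl
        · rw [show (i : ℕ) = n by omega])
      (fun a => ((fun i => a.1 i.castSucc, a.1 (Fin.last n)), a.2)) (fun _ => by simp)

/-- If each level set of `ξ` is `ε`-close to a set described by `η`, the conditional entropy of `ξ`
given `η` is small. -/
lemma condShannon_le_of_approx [IsProbabilityMeasure m] {ξ : Ω → ι} {η : Ω → κ}
    (hξ : Measurable ξ) (hη : Measurable η) (S : ι → Set κ) {ε s : ℝ} (hs0 : 0 < s) (hs1 : s ≤ 1)
    (h1 : ∀ i, m.real (ξ ⁻¹' {i} \ η ⁻¹' (S i)) ≤ ε)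
    (h2 : ∀ i, m.real (η ⁻¹' (S i) \ ξ ⁻¹' {i}) ≤ ε) :
    condShannon m ξ η ≤ Fintype.card ι * (ε + s + ε * (-Real.log s)) := by
  classical
  set p : ι → κ → ℝ := fun i j => m.real ((fun x => (ξ x, η x)) ⁻¹' {(i, j)}) with hp
  set q : κ → ℝ := fun j => m.real (η ⁻¹' {j}) with hq
  have hp0 : ∀ i b, 0 ≤ p i b := fun _ _ => measureReal_nonneg
  have hq0 : ∀ b, 0 ≤ q b := fun _ => measureReal_nonneg
  have hpq : ∀ b, ∑ i, p i b = q b := fun b => sum_marginal_snd hξ hη b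
  have hpleq : ∀ i b, p i b ≤ q b := fun i b => by
    rw [← hpq]; exact Finset.single_le_sum (f := fun i => p i b) (fun i _ => hp0 i b) (by simp)
  have e1 : condShannon m ξ η =
      ∑ i, ∑ j, p i j * (Real.log (q j) - Real.log (p i j)) := by
    rw [condShannon, shannon, shannon, Fintype.sum_prod_type]
    simp_rw [mul_sub, Finset.sum_sub_distrib]
    have : ∑ i, ∑ j, p i j * Real.log (q j) = ∑ j, q j * Real.log (q j) := by
      rw [Finset.sum_comm]
      simp_rw [← Finset.sum_mul, hpq]
    rw [this]
    simp only [Real.negMulLog, neg_mul, Finset.sum_neg_distrib]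
    simp only [hp, hq]
    ring
  -- `hA` is used where `η` predicts `ξ = i` (so that `q j - p i j` is small), `hB` elsewhere (where
  -- `p i j` is small); both come from `log t ≤ t - 1`
  have hA : ∀ i j, p i j * (Real.log (q j) - Real.log (p i j)) ≤ q j - p i j := by
    intro i j
    rcases (hp0 i j).eq_or_lt with h0 | h0
    · rw [← h0]; simp [hq0 j]
    · have hq1 := h0.trans_le (hpleq i j)
      rw [← Real.log_div hq1.ne' h0.ne']
      have := mul_le_mul_of_nonneg_left
        (Real.log_le_sub_one_of_pos (x := q j / p i j) (by positivity)) h0.le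
      refine this.trans (le_of_eq ?_)
      field_simp
  have hB : ∀ i j, p i j * (Real.log (q j) - Real.log (p i j)) ≤ s * q j + p i j * -Real.log s := by
    intro i j
    rcases (hp0 i j).eq_or_lt with h0 | h0
    · rw [← h0]; simp; exact mul_nonneg hs0.le (hq0 j)
    · have hq1 := h0.trans_le (hpleq i j)
      have := mul_le_mul_of_nonneg_left
        (Real.log_le_sub_one_of_pos (x := s * q j / p i j) (by positivity)) h0.le
      rw [Real.log_div (by positivity) h0.ne', Real.log_mul hs0.ne' hq1.ne'] at this
      have h3 : p i j * (s * q j / p i j - 1) = s * q j - p i j := by field_simp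
      rw [h3] at this
      linarith
  have hbound : ∀ i, ∑ j, p i j * (Real.log (q j) - Real.log (p i j)) ≤
      ε + s + ε * (-Real.log s) := by
    intro i
    rw [← Finset.sum_filter_add_sum_filter_not Finset.univ (fun j => j ∈ S i)]
    have hpi : ∀ (U : Finset κ), ∑ j ∈ U, p i j = m.real (ξ ⁻¹' {i} ∩ η ⁻¹' U) := by
      intro U
      simpa using sum_joint (m := m) hξ hη {i} U
    have hlog : 0 ≤ -Real.log s := by
      have := Real.log_nonpos hs0.le hs1
      linarith
    have b1 : ∑ j with j ∈ S i, p i j * (Real.log (q j) - Real.log (p i j)) ≤ ε := by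
      refine (Finset.sum_le_sum fun j _ => hA i j).trans ?_
      rw [Finset.sum_sub_distrib, hpi, ← measureReal_preimage_eq_sum hη]
      refine le_trans ?_ (h2 i)
      have hsub : η ⁻¹' (Finset.univ.filter (fun j => j ∈ S i) : Finset κ) = η ⁻¹' (S i) := by
        ext x; simp
      have := measureReal_sdiff_add_inter (μ := m) (s := η ⁻¹' (S i))
        (hξ (measurableSet_singleton i))
      rw [hsub, Set.inter_comm]
      linarith
    have b2 : ∑ j with ¬ j ∈ S i, p i j * (Real.log (q j) - Real.log (p i j)) ≤
        s + ε * (-Real.log s) := by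
      refine (Finset.sum_le_sum fun j _ => hB i j).trans ?_
      rw [Finset.sum_add_distrib, ← Finset.mul_sum, ← Finset.sum_mul, hpi,
        ← measureReal_preimage_eq_sum hη]
      have hsub : ξ ⁻¹' {i} ∩ η ⁻¹' (Finset.univ.filter (fun j => ¬ j ∈ S i) : Finset κ) =
          ξ ⁻¹' {i} \ η ⁻¹' (S i) := by
        ext x; simp
      rw [hsub]
      have := mul_le_mul_of_nonneg_right (h1 i) hlog
      have := mul_le_mul_of_nonneg_left (measureReal_le_one (μ := m)
        (s := η ⁻¹' (Finset.univ.filter (fun j => ¬ j ∈ S i) : Finset κ))) hs0.le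
      linarith
    linarith
  rw [e1]
  refine (Finset.sum_le_sum fun i _ => hbound i).trans (le_of_eq ?_)
  rw [Finset.sum_const, Finset.card_univ, nsmul_eq_mul]

end Shannon

/-! ### The partition into first symbols is a generator -/

section Generator

variable {k : ℕ} {X : Subshift (Fin k) ℕ} {m : Measure X.carrier} [IsProbabilityMeasure m]

lemma joinEntropy_eq_shannon {α : Type*} [MeasurableSpace α] (T : α → α) (m : Measure α) {r : ℕ}
    (ξ : α → Fin r) (n : ℕ) :
    joinEntropy T m ξ n = shannon m (fun x => fun i : Fin n => ξ (T^[i] x)) := by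
  refine Finset.sum_congr rfl fun w _ => ?_
  congr 2
  ext x
  simp [funext_iff]

lemma shannon_pre_add_le (hm : MeasurePreserving (sigma X) m m) (n N : ℕ) :
    shannon m (pre X (n + N)) ≤ shannon m (pre X n) + shannon m (pre X N) := by
  have hN := (measurable_pre (X := X) N).comp (hm.iterate n).measurable
  refine le_trans ?_ ((shannon_prod_le (m := m) (measurable_pre n) hN).trans
    (add_le_add_right (le_of_eq (shannon_comp_measurePreserving (hm.iterate n)
      (measurable_pre N))) _))
  refine shannon_comp_le ((measurable_pre n).prodMk hN)
    (fun a => fun i => if h : (i : ℕ) < n then a.1 ⟨i, h⟩ else a.2 ⟨i - n, by omega⟩) ?_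
  intro x
  ext i
  simp only [Function.comp_apply, pre, sigma_iterate_apply]
  split_ifs with h
  · rfl
  · rw [Nat.add_sub_cancel' (by omega)]

/-- Long words determine the value of `ξ` up to small conditional entropy, since its level sets are
approximated by unions of cylinders. -/
lemma exists_condShannon_pre_le {r : ℕ} {ξ : X.carrier → Fin r} (hξ : Measurable ξ) {ε : ℝ}
    (hε : 0 < ε) : ∃ N, condShannon m ξ (pre X N) ≤ ε := by
  -- `s` and `δ` make the bound `r (δ + s - δ log s)` at most `ε`
  set s : ℝ := min 1 (ε / (2 * (r + 1))) with hs
  have hr : (0 : ℝ) < r + 1 := by positivity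
  have hs0 : 0 < s := lt_min one_pos (by positivity)
  have hs1 : s ≤ 1 := min_le_left _ _
  have hlog : 0 ≤ -Real.log s := by
    have := Real.log_nonpos hs0.le hs1
    linarith
  set δ : ℝ := ε / (2 * (r + 1) * (1 + -Real.log s)) with hδ
  have hδ0 : 0 < δ := by positivity
  choose n S hS using fun i : Fin r =>
    exists_cylinder_approx m (hξ (measurableSet_singleton i)) hδ0
  obtain ⟨N, hN⟩ : ∃ N, ∀ i, n i ≤ N := ⟨Finset.univ.sup n, fun i => Finset.le_sup (by simp)⟩
  choose U hU using fun i => exists_pre_preimage_eq (X := X) (hN i) (S i)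
  refine ⟨N, (condShannon_le_of_approx hξ (measurable_pre N) U hs0 hs1 (ε := δ) ?_ ?_).trans ?_⟩
  · intro i
    rw [← hU]
    exact (measureReal_mono (by rw [Set.symmDiff_def]; exact Set.subset_union_right)).trans
      (hS i).le
  · intro i
    rw [← hU]
    exact (measureReal_mono (by rw [Set.symmDiff_def]; exact Set.subset_union_left)).trans
      (hS i).le
  · rw [Fintype.card_fin]
    have h1 : s * (r + 1) ≤ ε / 2 := by
      calc s * (r + 1) ≤ ε / (2 * (r + 1)) * (r + 1) :=
            mul_le_mul_of_nonneg_right (min_le_right _ _) hr.le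
        _ = ε / 2 := by field_simp
    have h2 : (r + 1) * (δ * (1 + -Real.log s)) = ε / 2 := by
      have : (1 + -Real.log s) ≠ 0 := by positivity
      rw [hδ]
      field_simp
    have h3 : 0 ≤ δ * (1 + -Real.log s) := by positivity
    linarith [hs0]

/-- The entropy of the join of `n` translates of any finite partition exceeds the entropy of the
partition into words of length `n` by at most an arbitrarily small linear term. -/
lemma exists_joinEntropy_le (hm : MeasurePreserving (sigma X) m m) {r : ℕ}
    {ξ : X.carrier → Fin r} (hξ : Measurable ξ) {ε : ℝ} (hε : 0 < ε) :
    ∃ K : ℝ, ∀ n, joinEntropy (sigma X) m ξ n ≤ shannon m (pre X n) + K + n * ε := by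
  obtain ⟨N, hN⟩ := exists_condShannon_pre_le (m := m) hξ hε
  refine ⟨shannon m (pre X N), fun n => ?_⟩
  have hmeas : ∀ i, Measurable fun x => ξ ((sigma X)^[i] x) :=
    fun i => hξ.comp (hm.iterate i).measurable
  rw [joinEntropy_eq_shannon]
  have hit : Measurable (fun x => fun i : Fin n => ξ ((sigma X)^[i] x)) :=
    measurable_pi_lambda _ fun i => hmeas i
  have h1 : shannon m (fun x => fun i : Fin n => ξ ((sigma X)^[i] x)) ≤
      shannon m (fun x => ((fun i : Fin n => ξ ((sigma X)^[i] x)), pre X (n + N) x)) :=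
    shannon_comp_le (hit.prodMk (measurable_pre _)) (fun a => a.1) fun _ => rfl
  have h2 := condShannon_tuple_le (m := m) (measurable_pre (X := X) (n + N)) n
    (fun i x => ξ ((sigma X)^[i] x)) hmeas
  have h3 : ∀ i ∈ Finset.range n,
      condShannon m (fun x => ξ ((sigma X)^[i] x)) (pre X (n + N)) ≤ ε := by
    intro i hi
    rw [Finset.mem_range] at hi
    calc condShannon m (fun x => ξ ((sigma X)^[i] x)) (pre X (n + N))
        ≤ condShannon m (fun x => ξ ((sigma X)^[i] x)) (fun x => pre X N ((sigma X)^[i] x)) := by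
          refine condShannon_le_of_comp (hmeas i) (measurable_pre _)
            ((measurable_pre (X := X) N).comp (hm.iterate i).measurable)
            (fun w => fun j => w ⟨i + j, by omega⟩) fun x => ?_
          ext j
          simp only [pre, sigma_iterate_apply]
      _ = condShannon m ξ (pre X N) :=
          condShannon_comp_measurePreserving (hm.iterate i) hξ (measurable_pre N)
      _ ≤ ε := hN
  have h4 := Finset.sum_le_sum h3
  rw [Finset.sum_const, Finset.card_range, nsmul_eq_mul] at h4
  have h5 := shannon_pre_add_le hm n N
  rw [condShannon] at h2
  linarith

/-- Kolmogorov–Sinai: the entropy of an invariant measure on a subshift is the growth rate of the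
entropies of the partitions into words; moreover it bounds these from below (Fekete). -/
lemma exists_entropy_eq (hm : MeasurePreserving (sigma X) m m) :
    ∃ h : ℝ, entropy (sigma X) m = h ∧ (∀ n : ℕ, n * h ≤ shannon m (pre X n)) ∧
      Tendsto (fun n : ℕ => shannon m (pre X n) / n) atTop (𝓝 h) := by
  have hsub : Subadditive fun n => shannon m (pre X n) := fun n N => shannon_pre_add_le hm n N
  have hbdd : BddBelow (Set.range fun n : ℕ => shannon m (pre X n) / n) :=
    ⟨0, by rintro _ ⟨n, rfl⟩; exact div_nonneg (shannon_nonneg _) (Nat.cast_nonneg _)⟩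
  have hlim := hsub.tendsto_lim hbdd
  refine ⟨hsub.lim, le_antisymm ?_ ?_, ?_, hlim⟩
  · refine iSup_le fun r => iSup_le fun ξ => iSup_le fun hξ => ?_
    refine EReal.le_of_forall_lt_iff_le.mp fun z hz => ?_
    have hz' : 0 < z - hsub.lim := sub_pos.mpr (EReal.coe_lt_coe_iff.mp hz)
    obtain ⟨K, hK⟩ := exists_joinEntropy_le hm hξ hz'
    have hT : Tendsto (fun n : ℕ =>
        ((shannon m (pre X n) / n + K / n + (z - hsub.lim) : ℝ) : EReal))
        atTop (𝓝 (z : EReal)) := by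
      have h := (hlim.add (tendsto_const_div_atTop_nhds_zero_nat K)).add_const (z - hsub.lim)
      rw [add_zero, add_sub_cancel] at h
      exact (continuous_coe_real_ereal.tendsto _).comp h
    rw [← hT.limsup_eq]
    refine limsup_le_limsup ?_
    filter_upwards [eventually_gt_atTop 0] with n hn
    rw [EReal.coe_le_coe_iff]
    have hn' : (0 : ℝ) < n := Nat.cast_pos.mpr hn
    rw [div_le_iff₀ hn', add_mul, add_mul, div_mul_cancel₀ _ hn'.ne', div_mul_cancel₀ _ hn'.ne']
    linarith [hK n]
  · have h0 : Measurable fun x : X.carrier => x.1 0 :=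
      (measurable_pi_apply 0).comp measurable_subtype_coe
    refine le_trans (le_of_eq ?_) (le_iSup_of_le k (le_iSup_of_le (fun x => x.1 0)
      (le_iSup_of_le h0 le_rfl)))
    have hT := (continuous_coe_real_ereal.tendsto _).comp hlim
    rw [← hT.limsup_eq]
    congr 1
    ext n
    rw [joinEntropy_eq_shannon]
    simp [sigma_iterate_apply]
    rfl
  · intro n
    rcases Nat.eq_zero_or_pos n with rfl | hn
    · simpa using shannon_nonneg _
    · have := hsub.lim_le_div hbdd hn.ne'
      rw [le_div_iff₀ (Nat.cast_pos.mpr hn)] at this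
      linarith

end Generator

/-! ### Comparison of `log f_n` with the Birkhoff sums of `f̂` -/

section Hat

variable {k : ℕ} {X : Subshift (Fin k) ℕ} {f : ℕ → X.carrier → ℝ}

lemma AdditiveUpTo.abs_log_sub_le {C : ℝ} {n m : ℕ} {x : X.carrier} (h : AdditiveUpTo f C n m x)
    (hn : 0 < f n x) (hm : 0 < f m ((sigma X)^[n] x)) (hnm : 0 < f (n + m) x) :
    |Real.log (f (n + m) x) - Real.log (f n x) - Real.log (f m ((sigma X)^[n] x))| ≤ C := by
  have h1 := Real.log_le_log hnm h.1
  have h2 := Real.log_le_log (by positivity) h.2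
  rw [Real.log_mul (by positivity) hm.ne', Real.log_mul (by positivity) hn.ne', Real.log_exp]
    at h1 h2
  rw [abs_le]
  constructor <;> linarith

lemma exists_log_bound {n : ℕ} (hcont : Continuous (f n)) (hpos : ∀ x, 0 < f n x) :
    ∃ B, ∀ x, |Real.log (f n x)| ≤ B := by
  have h : Continuous fun x => Real.log (f n x) := hcont.log fun x => (hpos x).ne'
  obtain ⟨B, hB⟩ := isCompact_univ.exists_bound_of_continuousOn h.continuousOn
  exact ⟨B, fun x => hB x trivial⟩

lemma abs_ratio_le {C B : ℝ} (hpos : ∀ n, 1 ≤ n → ∀ x, 0 < f n x)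
    (hadd : ∀ m, 1 ≤ m → ∀ x, AdditiveUpTo f C 1 m x) (hB : ∀ x, |Real.log (f 1 x)| ≤ B)
    {n : ℕ} (hn : 1 ≤ n) (x : X.carrier) :
    |Real.log (f (n + 1) x / f n (sigma X x))| ≤ C + B := by
  have h := (hadd n hn x).abs_log_sub_le (hpos 1 le_rfl x) (hpos n hn _) (hpos _ (by omega) x)
  rw [Function.iterate_one, add_comm 1 n] at h
  rw [Real.log_div (hpos _ (by omega) x).ne' (hpos n hn _).ne']
  have := abs_add_le (Real.log (f (n + 1) x) - Real.log (f 1 x) - Real.log (f n (sigma X x)))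
    (Real.log (f 1 x))
  calc _ = |Real.log (f (n + 1) x) - Real.log (f 1 x) - Real.log (f n (sigma X x)) +
      Real.log (f 1 x)| := by congr 1; ring
    _ ≤ _ := this.trans (add_le_add h (hB x))

/-- A bounded real sequence whose lower and upper limits in `[-∞, ∞]` agree converges to the real
part of the upper limit. -/
lemma tendsto_toReal_limsup {u : ℕ → ℝ} {B : ℝ} (hu : ∀ n, 1 ≤ n → |u n| ≤ B)
    (h : liminf (fun n => (u n : EReal)) atTop = limsup (fun n => (u n : EReal)) atTop) :
    Tendsto u atTop (𝓝 (limsup (fun n => (u n : EReal)) atTop).toReal) := by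
  have ht := tendsto_of_liminf_eq_limsup h rfl
  set L := limsup (fun n => (u n : EReal)) atTop
  have h1 : L ≤ (B : EReal) := le_of_tendsto ht (by
    filter_upwards [eventually_ge_atTop 1] with n hn
    exact EReal.coe_le_coe_iff.mpr (abs_le.mp (hu n hn)).2)
  have h2 : ((-B : ℝ) : EReal) ≤ L := ge_of_tendsto ht (by
    filter_upwards [eventually_ge_atTop 1] with n hn
    exact EReal.coe_le_coe_iff.mpr (abs_le.mp (hu n hn)).1)
  have h3 : ((L.toReal : ℝ) : EReal) = L :=
    EReal.coe_toReal (h1.trans_lt (EReal.coe_lt_top _)).ne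
      ((EReal.bot_lt_coe _).trans_le h2).ne'
  rw [← h3] at ht
  exact EReal.tendsto_coe.mp ht

lemma tendsto_hatF {C B : ℝ} (hpos : ∀ n, 1 ≤ n → ∀ x, 0 < f n x)
    (hadd : ∀ m, 1 ≤ m → ∀ x, AdditiveUpTo f C 1 m x) (hB : ∀ x, |Real.log (f 1 x)| ≤ B)
    (hlim : ∀ x, lowerRatio f x = upperRatio f x) (x : X.carrier) :
    Tendsto (fun n : ℕ => Real.log (f (n + 1) x / f n (sigma X x))) atTop (𝓝 (hatF f x)) :=
  tendsto_toReal_limsup (fun _ hn => abs_ratio_le hpos hadd hB hn x) (hlim x)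

lemma abs_hatF_le {C B : ℝ} (hpos : ∀ n, 1 ≤ n → ∀ x, 0 < f n x)
    (hadd : ∀ m, 1 ≤ m → ∀ x, AdditiveUpTo f C 1 m x) (hB : ∀ x, |Real.log (f 1 x)| ≤ B)
    (hlim : ∀ x, lowerRatio f x = upperRatio f x) (x : X.carrier) : |hatF f x| ≤ C + B :=
  le_of_tendsto (tendsto_hatF hpos hadd hB hlim x).abs (by
    filter_upwards [eventually_ge_atTop 1] with n hn
    exact abs_ratio_le hpos hadd hB hn x)

lemma measurable_hatF (hcont : ∀ n, 1 ≤ n → Continuous (f n))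
    (htend : ∀ x, Tendsto (fun n : ℕ => Real.log (f (n + 1) x / f n (sigma X x))) atTop
      (𝓝 (hatF f x))) : Measurable (hatF f) := by
  -- the ratio with index `0` involves the unconstrained function `f 0`, hence the shift
  refine measurable_of_tendsto_metrizable
    (f := fun n x => Real.log (f (n + 1 + 1) x / f (n + 1) (sigma X x))) (fun n => ?_)
    (tendsto_pi_nhds.mpr fun x => (htend x).comp (tendsto_add_atTop_nat 1))
  exact (((hcont _ (by omega)).measurable).div
    ((hcont _ (by omega)).measurable.comp measurable_sigma)).log

/-- `f_{n+m}(x) / f_m(σⁿ x)` telescopes into a product of `n` consecutive ratios, so that its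
logarithm tends to the Birkhoff sum of `f̂` as `m → ∞`. -/
lemma tendsto_log_sub_birkhoffSum (hpos : ∀ n, 1 ≤ n → ∀ x, 0 < f n x)
    (htend : ∀ x, Tendsto (fun n : ℕ => Real.log (f (n + 1) x / f n (sigma X x))) atTop
      (𝓝 (hatF f x))) (n : ℕ) (x : X.carrier) :
    Tendsto (fun m => Real.log (f (n + m) x) - Real.log (f m ((sigma X)^[n] x))) atTop
      (𝓝 (birkhoffSum (sigma X) (hatF f) n x)) := by
  induction n generalizing x with
  | zero => simp
  | succ n ih =>
    rw [birkhoffSum_succ']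
    refine ((((htend x).comp (tendsto_add_atTop_nat n)).add (ih (sigma X x)))).congr' ?_
    filter_upwards [eventually_ge_atTop 1] with m hm
    simp only [Function.comp_apply]
    rw [Real.log_div (hpos _ (by omega) x).ne' (hpos _ (by omega) _).ne', add_comm m n,
      Function.iterate_succ_apply, show n + 1 + m = n + m + 1 by ring]
    ring

lemma abs_log_sub_birkhoffSum_le {C : ℝ} (hpos : ∀ n, 1 ≤ n → ∀ x, 0 < f n x)
    (htend : ∀ x, Tendsto (fun n : ℕ => Real.log (f (n + 1) x / f n (sigma X x))) atTop
      (𝓝 (hatF f x))) {n : ℕ} (hn : 1 ≤ n) (hadd : ∀ m, 1 ≤ m → ∀ x, AdditiveUpTo f C n m x)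
    (x : X.carrier) :
    |Real.log (f n x) - birkhoffSum (sigma X) (hatF f) n x| ≤ C := by
  rw [abs_sub_comm]
  refine le_of_tendsto ((tendsto_log_sub_birkhoffSum hpos htend n x).sub_const
    (Real.log (f n x))).abs ?_
  filter_upwards [eventually_ge_atTop 1] with m hm
  have := (hadd m hm x).abs_log_sub_le (hpos n hn x) (hpos m hm _) (hpos _ (by omega) x)
  rwa [sub_right_comm] at this

lemma integral_birkhoffSum {m : Measure X.carrier} [IsProbabilityMeasure m]
    (hm : MeasurePreserving (sigma X) m m) {g : X.carrier → ℝ} (hg : Measurable g)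
    (hint : Integrable g m) (n : ℕ) :
    ∫ x, birkhoffSum (sigma X) g n x ∂m = n * ∫ x, g x ∂m := by
  have h1 : ∀ i, ∫ x, g ((sigma X)^[i] x) ∂m = ∫ x, g x ∂m := fun i => by
    have h := hm.iterate i
    rw [← integral_map h.measurable.aemeasurable (by rw [h.map_eq]; exact hg.aestronglyMeasurable),
      h.map_eq]
  simp only [birkhoffSum]
  rw [integral_finsetSum (f := fun i x => g ((sigma X)^[i] x)) _
    fun i _ => (hm.iterate i).integrable_comp_of_integrable hint]
  simp [h1]

lemma abs_integral_log_sub_le {C : ℝ} {m : Measure X.carrier} [IsProbabilityMeasure m]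
    (hm : MeasurePreserving (sigma X) m m) {g : X.carrier → ℝ} (hg : Measurable g)
    (hint : Integrable g m) {n : ℕ} (hcont : Continuous (f n)) (hpos : ∀ x, 0 < f n x)
    (h : ∀ x, |Real.log (f n x) - birkhoffSum (sigma X) g n x| ≤ C) :
    |∫ x, Real.log (f n x) ∂m - n * ∫ x, g x ∂m| ≤ C := by
  have hi : Integrable (fun x => Real.log (f n x)) m := by
    obtain ⟨B, hB⟩ := exists_log_bound hcont hpos
    exact Integrable.of_bound (hcont.log fun x => (hpos x).ne').aestronglyMeasurable B
      (Eventually.of_forall hB)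
  have hb : Integrable (birkhoffSum (sigma X) g n) m :=
    integrable_finsetSum _ fun i _ => (hm.iterate i).integrable_comp_of_integrable hint
  rw [← integral_birkhoffSum hm hg hint, ← integral_sub hi hb]
  have := norm_integral_le_of_norm_le_const (μ := m) (f := fun x => Real.log (f n x) -
    birkhoffSum (sigma X) g n x) (C := C) (Eventually.of_forall h)
  simpa using this

lemma isBoundedBorelApprox_of_abs_le {C : ℕ → ℝ} {B : ℝ} {g : X.carrier → ℝ} (hg : Measurable g)
    (hB : ∀ x, |g x| ≤ B) (hcont : ∀ n, 1 ≤ n → Continuous (f n))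
    (hpos : ∀ n, 1 ≤ n → ∀ x, 0 < f n x)
    (hC : Tendsto (fun n : ℕ => C n / n) atTop (𝓝 0))
    (h : ∀ n, 1 ≤ n → ∀ x, |Real.log (f n x) - birkhoffSum (sigma X) g n x| ≤ C n) :
    IsBoundedBorelApprox f g := by
  refine ⟨⟨B, hB⟩, hg, ?_, ?_⟩
  · have hC' : Tendsto (fun n : ℕ => ENNReal.ofReal (C n / n)) atTop (𝓝 0) := by
      simpa using ENNReal.tendsto_ofReal hC
    refine tendsto_of_tendsto_of_tendsto_of_le_of_le' tendsto_const_nhds hC'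
      (Eventually.of_forall fun _ => zero_le) ?_
    filter_upwards [eventually_ge_atTop 1] with n hn
    rw [ENNReal.ofReal_div_of_pos (by exact_mod_cast hn), ENNReal.ofReal_natCast]
    gcongr
    exact iSup_le fun x => ENNReal.ofReal_le_ofReal (h n hn x)
  · rintro m ⟨hm1, hm2⟩
    have hint : Integrable g m :=
      Integrable.of_bound hg.aestronglyMeasurable B (Eventually.of_forall hB)
    rw [tendsto_iff_norm_sub_tendsto_zero]
    refine squeeze_zero' (Eventually.of_forall fun _ => norm_nonneg _) ?_ hC
    filter_upwards [eventually_ge_atTop 1] with n hn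
    have hn' : (0 : ℝ) < n := by exact_mod_cast hn
    have := abs_integral_log_sub_le hm2 hg hint (hcont n hn) (hpos n hn) (h n hn)
    calc ‖1 / (n : ℝ) * ∫ x, Real.log (f n x) ∂m - ∫ x, g x ∂m‖
        = |∫ x, Real.log (f n x) ∂m - n * ∫ x, g x ∂m| / n := by
          rw [Real.norm_eq_abs, ← abs_of_pos hn', ← abs_div, abs_of_pos hn']
          congr 1
          field_simp
      _ ≤ C n / n := by gcongr

lemma energy_eq_of_isBoundedBorelApprox {g : X.carrier → ℝ} (h : IsBoundedBorelApprox f g)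
    {m : Measure X.carrier} (hm : m ∈ invariantMeasures X) :
    energy f m = ((∫ x, g x ∂m : ℝ) : EReal) :=
  ((continuous_coe_real_ereal.tendsto _).comp (h.2.2.2 m hm)).limsup_eq

lemma equilibriumStates_eq_of_isBoundedBorelApprox {g : X.carrier → ℝ}
    (h : IsBoundedBorelApprox f g) : equilibriumStates f = equilibriumStatesFun g := by
  have hsup : (⨆ m ∈ invariantMeasures X, (entropy (sigma X) m + energy f m)) =
      ⨆ m ∈ invariantMeasures X, (entropy (sigma X) m + ((∫ x, g x ∂m : ℝ) : EReal)) :=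
    iSup_congr fun m => iSup_congr fun hm => by rw [energy_eq_of_isBoundedBorelApprox h hm]
  ext μ
  simp only [equilibriumStates, equilibriumStatesFun, Set.mem_ofPred_eq, hsup]
  refine and_congr_right fun hμ => ?_
  rw [energy_eq_of_isBoundedBorelApprox h hμ]

/-- Replacing `a` by `b` with `|log a - log b| ≤ c` in the Gibbs bound costs a factor `e^c`. -/
lemma gibbs_bound_of_abs_log_le {a b c D t P : ℝ} {n : ℕ} (ha : 0 < a) (hb : 0 < b) (hD : 0 < D)
    (hab : |Real.log a - Real.log b| ≤ c)
    (h1 : 1 / D ≤ t / (Real.exp (-n * P) * a)) (h2 : t / (Real.exp (-n * P) * a) ≤ D) :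
    1 / (D * Real.exp c) ≤ t / (Real.exp (-n * P) * b) ∧
      t / (Real.exp (-n * P) * b) ≤ D * Real.exp c := by
  rw [abs_le] at hab
  have e1 : a ≤ Real.exp c * b := by
    have := Real.exp_le_exp.mpr (show Real.log a ≤ c + Real.log b by linarith)
    rwa [Real.exp_add, Real.exp_log ha, Real.exp_log hb] at this
  have e2 : b ≤ Real.exp c * a := by
    have := Real.exp_le_exp.mpr (show Real.log b ≤ c + Real.log a by linarith)
    rwa [Real.exp_add, Real.exp_log ha, Real.exp_log hb] at this
  have hE := Real.exp_pos (-n * P)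
  have hc := Real.exp_pos c
  set E := Real.exp (-n * P)
  set e := Real.exp c
  rw [div_le_div_iff₀ hD (by positivity), one_mul] at h1
  rw [div_le_iff₀ (by positivity)] at h2
  constructor
  · rw [div_le_div_iff₀ (by positivity) (by positivity), one_mul]
    calc E * b ≤ E * (e * a) := by gcongr
      _ = e * (E * a) := by ring
      _ ≤ e * (t * D) := by gcongr
      _ = t * (D * e) := by ring
  · rw [div_le_iff₀ (by positivity)]
    calc t ≤ D * (E * a) := h2
      _ ≤ D * (E * (e * b)) := by gcongr
      _ = D * e * (E * b) := by ring

lemma invariantGibbs_subset_of_abs_log_le {g : ℕ → X.carrier → ℝ} {c : ℝ}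
    (hf : ∀ n, 1 ≤ n → ∀ x, 0 < f n x) (hg : ∀ n, 1 ≤ n → ∀ x, 0 < g n x)
    (h : ∀ n, 1 ≤ n → ∀ x, |Real.log (f n x) - Real.log (g n x)| ≤ c) :
    invariantGibbs f ⊆ invariantGibbs g := by
  rintro μ ⟨hμ, P, D, hD, hb⟩
  exact ⟨hμ, P, D * Real.exp c, by positivity, fun n hn x =>
    gibbs_bound_of_abs_log_le (hf n hn x) (hg n hn x) hD (h n hn x) (hb n hn x).1 (hb n hn x).2⟩

lemma mem_invariantWeakGibbs_of_abs_log_le {g : ℕ → X.carrier → ℝ} {c : ℕ → ℝ}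
    (hf : ∀ n, 1 ≤ n → ∀ x, 0 < f n x) (hg : ∀ n, 1 ≤ n → ∀ x, 0 < g n x)
    (hc : Tendsto (fun n : ℕ => c n / n) atTop (𝓝 0))
    (h : ∀ n, 1 ≤ n → ∀ x, |Real.log (f n x) - Real.log (g n x)| ≤ c n)
    {μ : Measure X.carrier} (hμ : μ ∈ invariantGibbs f) : μ ∈ invariantWeakGibbs g := by
  obtain ⟨hμ, P, D, hD, hb⟩ := hμ
  refine ⟨hμ, P, fun n => D * Real.exp (c n), fun n _ => by positivity, ?_, fun n hn x =>
    gibbs_bound_of_abs_log_le (hf n hn x) (hg n hn x) hD (h n hn x) (hb n hn x).1 (hb n hn x).2⟩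
  have := (tendsto_const_div_atTop_nhds_zero_nat (Real.log D)).add hc
  rw [add_zero] at this
  refine this.congr fun n => ?_
  rw [Real.log_mul hD.ne' (Real.exp_ne_zero _), Real.log_exp]
  ring

end Hat

/-! ### Partition functions -/

section Partition

variable {k : ℕ} {X : Subshift (Fin k) ℕ}

/-- Additive notation for almost additive sequences of bounded variation: `φ n` stands for
`log f_n`, and the (free) value at `0` is normalised to `0` so that the bounds hold for all
indices. -/
structure IsQuasiAdditive (φ : ℕ → X.carrier → ℝ) (C M : ℝ) : Prop where
  zero : ∀ x, φ 0 x = 0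
  abs_add_le : ∀ n m x, |φ (n + m) x - φ n x - φ m ((sigma X)^[n] x)| ≤ C
  var_le : ∀ n x y, pre X n x = pre X n y → φ n x - φ n y ≤ M
  bdd : ∀ n, ∃ B, ∀ x, |φ n x| ≤ B

lemma IsQuasiAdditive.exists_bound {φ : ℕ → X.carrier → ℝ} {C M : ℝ} (h : IsQuasiAdditive φ C M)
    (p : ℕ) : ∃ B, ∀ l ≤ p, ∀ x, |φ l x| ≤ B := by
  choose B hB using h.bdd
  refine ⟨∑ l ∈ Finset.range (p + 1), |B l|, fun l hl x => ?_⟩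
  refine (hB l x).trans ((le_abs_self _).trans ?_)
  exact Finset.single_le_sum (f := fun l => |B l|) (fun _ _ => abs_nonneg _)
    (Finset.mem_range.mpr (by omega))

/-- Joining two words with a gap of bounded length changes the sum of their values of `φ` by a
bounded amount. -/
lemma IsQuasiAdditive.abs_glue_le {φ : ℕ → X.carrier → ℝ} {C M B : ℝ} (h : IsQuasiAdditive φ C M)
    {p : ℕ} (hB : ∀ l ≤ p, ∀ x, |φ l x| ≤ B) {n m l : ℕ} (hl : l ≤ p) {x y z : X.carrier}
    (hx : pre X n z = pre X n x) (hy : pre X m ((sigma X)^[n + l] z) = pre X m y) :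
    |φ (n + l + m) z - φ n x - φ m y| ≤ 2 * C + 2 * M + B := by
  have h1 := abs_le.mp (h.abs_add_le (n + l) m z)
  have h2 := abs_le.mp (h.abs_add_le n l z)
  have h3 := abs_le.mp (hB l hl ((sigma X)^[n] z))
  have h4 := h.var_le n _ _ hx
  have h5 := h.var_le n _ _ hx.symm
  have h6 := h.var_le m _ _ hy
  have h7 := h.var_le m _ _ hy.symm
  rw [abs_le]
  constructor <;> linarith

open Classical in
/-- The words of length `n` of `X`. -/
def words (X : Subshift (Fin k) ℕ) (n : ℕ) : Finset (Fin n → Fin k) :=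
  Finset.univ.filter fun w => ∃ x, pre X n x = w

lemma pre_mem_words (n : ℕ) (x : X.carrier) : pre X n x ∈ words X n := by simp [words]

variable [Nonempty X.carrier]

/-- A point of `X` starting with the word `w`, if there is one. -/
def rep (X : Subshift (Fin k) ℕ) [Nonempty X.carrier] (n : ℕ) (w : Fin n → Fin k) : X.carrier :=
  Function.invFun (pre X n) w

lemma pre_rep {n : ℕ} {w : Fin n → Fin k} (hw : w ∈ words X n) : pre X n (rep X n w) = w :=
  Function.invFun_eq (by simpa [words] using hw)

lemma pre_rep_pre (n : ℕ) (x : X.carrier) : pre X n (rep X n (pre X n x)) = pre X n x :=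
  pre_rep (pre_mem_words n x)

/-- The weight `e^{φ_n}` of a word of length `n`, evaluated at a representative. -/
def wt (φ : ℕ → X.carrier → ℝ) (n : ℕ) (w : Fin n → Fin k) : ℝ := Real.exp (φ n (rep X n w))

/-- The partition function: the sum of the weights of the words of length `n`. -/
def partitionFn (φ : ℕ → X.carrier → ℝ) (n : ℕ) : ℝ := ∑ w ∈ words X n, wt φ n w

open Classical in
/-- The words of length `n + m` that extend the first `n` symbols of `x`. -/
def extensions (n m : ℕ) (x : X.carrier) : Finset (Fin (n + m) → Fin k) :=
  (words X (n + m)).filter fun w => pre X n (rep X (n + m) w) = pre X n x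

variable {φ : ℕ → X.carrier → ℝ} {C M : ℝ}

lemma wt_pos (n : ℕ) (w : Fin n → Fin k) : 0 < wt φ n w := Real.exp_pos _

lemma partitionFn_pos (n : ℕ) : 0 < partitionFn φ n :=
  Finset.sum_pos (fun w _ => wt_pos n w)
    ⟨pre X n (Classical.arbitrary _), pre_mem_words n _⟩

lemma partitionFn_add_eq_sum_extensions (n m : ℕ) :
    partitionFn φ (n + m) =
      ∑ u ∈ words X n, ∑ w ∈ extensions n m (rep X n u), wt φ (n + m) w := by
  classical
  rw [partitionFn, ← Finset.sum_fiberwise_of_maps_to (t := words X n)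
    (g := fun w => pre X n (rep X (n + m) w)) fun w _ => pre_mem_words n _]
  refine Finset.sum_congr rfl fun u hu => Finset.sum_congr ?_ fun _ _ => rfl
  simp [extensions, pre_rep hu]

/-- An extension is determined by its last `m` symbols, and weights are submultiplicative up to a
bounded factor. -/
lemma sum_extensions_le (h : IsQuasiAdditive φ C M) (n m : ℕ) (x : X.carrier) :
    ∑ w ∈ extensions n m x, wt φ (n + m) w ≤
      Real.exp (φ n x + (C + 2 * M)) * partitionFn φ m := by
  classical
  set t : (Fin (n + m) → Fin k) → (Fin m → Fin k) :=
    fun w => pre X m ((sigma X)^[n] (rep X (n + m) w)) with ht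
  have hterm : ∀ w ∈ extensions n m x, wt φ (n + m) w ≤
      Real.exp (φ n x + (C + 2 * M)) * wt φ m (t w) := by
    intro w hw
    rw [wt, wt, ← Real.exp_add, Real.exp_le_exp]
    have h1 := abs_le.mp (h.abs_add_le n m (rep X (n + m) w))
    have h2 := h.var_le n _ _ (Finset.mem_filter.mp hw).2
    have h3 := h.var_le m _ _ (pre_rep_pre m ((sigma X)^[n] (rep X (n + m) w))).symm
    linarith
  have hinj : Set.InjOn t (extensions n m x) := by
    intro w hw w' hw' hww
    have hw := Finset.mem_filter.mp hw
    have hw' := Finset.mem_filter.mp hw'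
    rw [← pre_rep hw.1, ← pre_rep hw'.1]
    exact pre_add_eq (hw.2.trans hw'.2.symm) hww
  refine (Finset.sum_le_sum hterm).trans ?_
  rw [← Finset.mul_sum]
  refine mul_le_mul_of_nonneg_left ?_ (Real.exp_pos _).le
  rw [← Finset.sum_image (f := fun v => wt φ m v) hinj]
  refine Finset.sum_le_sum_of_subset_of_nonneg ?_ fun _ _ _ => (wt_pos _ _).le
  intro v hv
  obtain ⟨w, -, rfl⟩ := Finset.mem_image.mp hv
  exact pre_mem_words m _

/-- Every word of length `m` occurs, after a gap of length at most `p`, in an extension of length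
`m + p` of a given word. Since the gap length is not fixed, an extension may serve up to `p + 1`
words. -/
lemma le_sum_extensions (h : IsQuasiAdditive φ C M) {p : ℕ} (hp : GlueWithin X p) {B : ℝ}
    (hB : ∀ l ≤ p, ∀ x, |φ l x| ≤ B) (n m : ℕ) (x : X.carrier) :
    Real.exp (φ n x) * partitionFn φ m ≤ Real.exp (3 * C + 3 * M + 2 * B + p) *
      ∑ w ∈ extensions n (m + p) x, wt φ (n + (m + p)) w := by
  classical
  choose l hl z hz1 hz2 using fun v : Fin m → Fin k => hp n m x (rep X m v)
  set e : (Fin m → Fin k) → ℕ × (Fin (n + (m + p)) → Fin k) :=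
    fun v => (l v, pre X (n + (m + p)) (z v)) with he
  have hterm : ∀ v ∈ words X m, Real.exp (φ n x) * wt φ m v ≤
      Real.exp (3 * C + 3 * M + 2 * B) * wt φ (n + (m + p)) (e v).2 := by
    intro v _
    rw [wt, wt, ← Real.exp_add, ← Real.exp_add, Real.exp_le_exp]
    have h1 := abs_le.mp (h.abs_glue_le hB (hl v) (hz1 v) (hz2 v))
    have h2 := h.var_le _ _ _ (pre_rep_pre (n + (m + p)) (z v)).symm
    have h3 := abs_le.mp (h.abs_add_le (n + l v + m) (p - l v) (z v))
    have h4 := abs_le.mp (hB (p - l v) (by omega) ((sigma X)^[n + l v + m] (z v)))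
    have h5 : n + l v + m + (p - l v) = n + (m + p) := by have := hl v; omega
    rw [h5] at h3
    simp only [he]
    linarith
  have hinj : Set.InjOn e (words X m) := by
    intro v hv v' hv' hvv
    obtain ⟨h1, h2⟩ := Prod.mk.inj hvv
    rw [← pre_rep hv, ← pre_rep hv', ← hz2 v, ← hz2 v', ← h1]
    refine pre_sigma_eq (pre_eq_of_le ?_ h2)
    have := hl v
    omega
  have hmaps : ∀ v ∈ words X m, e v ∈ Finset.range (p + 1) ×ˢ extensions n (m + p) x := by
    intro v _
    refine Finset.mem_product.mpr ⟨Finset.mem_range.mpr (Nat.lt_succ_of_le (hl v)),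
      Finset.mem_filter.mpr ⟨pre_mem_words _ _, ?_⟩⟩
    exact (pre_eq_of_le (by omega) (pre_rep_pre (n + (m + p)) (z v))).trans (hz1 v)
  calc Real.exp (φ n x) * partitionFn φ m
      = ∑ v ∈ words X m, Real.exp (φ n x) * wt φ m v := by rw [partitionFn, Finset.mul_sum]
    _ ≤ ∑ v ∈ words X m, Real.exp (3 * C + 3 * M + 2 * B) * wt φ (n + (m + p)) (e v).2 :=
        Finset.sum_le_sum hterm
    _ = ∑ b ∈ (words X m).image e,
          Real.exp (3 * C + 3 * M + 2 * B) * wt φ (n + (m + p)) b.2 :=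
        (Finset.sum_image (f := fun b : ℕ × (Fin (n + (m + p)) → Fin k) =>
          Real.exp (3 * C + 3 * M + 2 * B) * wt φ (n + (m + p)) b.2) hinj).symm
    _ ≤ ∑ b ∈ Finset.range (p + 1) ×ˢ extensions n (m + p) x,
          Real.exp (3 * C + 3 * M + 2 * B) * wt φ (n + (m + p)) b.2 := by
        refine Finset.sum_le_sum_of_subset_of_nonneg ?_
          fun _ _ _ => mul_nonneg (Real.exp_pos _).le (wt_pos _ _).le
        intro b hb
        obtain ⟨v, hv, rfl⟩ := Finset.mem_image.mp hb
        exact hmaps v hv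
    _ = Real.exp (3 * C + 3 * M + 2 * B) * (p + 1) *
          ∑ w ∈ extensions n (m + p) x, wt φ (n + (m + p)) w := by
        rw [Finset.sum_product]
        simp only [← Finset.mul_sum, Finset.sum_const, Finset.card_range, nsmul_eq_mul]
        push_cast
        ring
    _ ≤ _ := by
        rw [Real.exp_add _ (p : ℝ)]
        have := Real.add_one_le_exp (p : ℝ)
        have h0 : 0 ≤ ∑ w ∈ extensions n (m + p) x, wt φ (n + (m + p)) w :=
          Finset.sum_nonneg fun _ _ => (wt_pos _ _).le
        gcongr

lemma partitionFn_add_le (h : IsQuasiAdditive φ C M) (n m : ℕ) :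
    partitionFn φ (n + m) ≤ Real.exp (C + 2 * M) * (partitionFn φ n * partitionFn φ m) := by
  rw [partitionFn_add_eq_sum_extensions]
  refine (Finset.sum_le_sum fun u _ => sum_extensions_le h n m (rep X n u)).trans (le_of_eq ?_)
  simp_rw [Real.exp_add]
  rw [← Finset.sum_mul, ← Finset.sum_mul]
  change partitionFn φ n * _ * _ = _
  ring

lemma le_partitionFn_add (h : IsQuasiAdditive φ C M) {p : ℕ} (hp : GlueWithin X p) {B : ℝ}
    (hB : ∀ l ≤ p, ∀ x, |φ l x| ≤ B) (n m : ℕ) :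
    partitionFn φ n * partitionFn φ m ≤
      Real.exp (3 * C + 3 * M + 2 * B + p) * Real.exp (C + 2 * M) * partitionFn φ p *
        partitionFn φ (n + m) := by
  have h1 := Finset.sum_le_sum fun u (_ : u ∈ words X n) =>
    le_sum_extensions h hp hB n m (rep X n u)
  rw [← Finset.sum_mul, ← Finset.mul_sum, ← partitionFn_add_eq_sum_extensions] at h1
  have h2 := partitionFn_add_le h (n + m) p
  rw [add_assoc] at h2
  calc partitionFn φ n * partitionFn φ m
      ≤ Real.exp (3 * C + 3 * M + 2 * B + p) * partitionFn φ (n + (m + p)) := h1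
    _ ≤ Real.exp (3 * C + 3 * M + 2 * B + p) *
        (Real.exp (C + 2 * M) * (partitionFn φ (n + m) * partitionFn φ p)) := by gcongr
    _ = _ := by ring

/-- A sequence that is additive up to a bounded error is linear up to a bounded error. -/
lemma exists_abs_sub_linear_le {a : ℕ → ℝ} {K : ℝ} (h : ∀ n m, |a (n + m) - a n - a m| ≤ K) :
    ∃ P, ∀ n : ℕ, |a n - n * P| ≤ K := by
  have hK : 0 ≤ K := (abs_nonneg _).trans (h 0 0)
  have hmul : ∀ m n : ℕ, |a ((m + 1) * n) - (m + 1) * a n| ≤ m * K := by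
    intro m n
    induction m with
    | zero => simp
    | succ m ih =>
      have h1 := abs_le.mp (h ((m + 1) * n) n)
      have h2 := abs_le.mp ih
      rw [show (m + 1 + 1) * n = (m + 1) * n + n by ring]
      push_cast
      rw [abs_le]
      constructor <;> linarith
  have key : ∀ m n : ℕ, (a (n + 1) - K) / (n + 1) ≤ (a (m + 1) + K) / (m + 1) := by
    intro m n
    have h1 := abs_le.mp (hmul m (n + 1))
    have h2 := abs_le.mp (hmul n (m + 1))
    rw [mul_comm (n + 1) (m + 1)] at h2
    rw [div_le_div_iff₀ (by positivity) (by positivity)]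
    linarith
  have hbdd : BddAbove (Set.range fun n : ℕ => (a (n + 1) - K) / (n + 1)) :=
    ⟨_, by rintro _ ⟨n, rfl⟩; exact key 0 n⟩
  refine ⟨⨆ n : ℕ, (a (n + 1) - K) / (n + 1), fun n => ?_⟩
  cases n with
  | zero =>
    have := h 0 0
    simpa using this
  | succ n =>
    have h1 : (a (n + 1) - K) / (n + 1) ≤ ⨆ n : ℕ, (a (n + 1) - K) / (n + 1) :=
      le_ciSup hbdd n
    have h2 : ⨆ n : ℕ, (a (n + 1) - K) / (n + 1) ≤ (a (n + 1) + K) / (n + 1) :=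
      ciSup_le fun m => key n m
    rw [div_le_iff₀ (by positivity)] at h1
    rw [le_div_iff₀ (by positivity)] at h2
    push_cast
    rw [abs_le]
    constructor <;> linarith

/-- The partition function grows like `e^{nP}` up to a bounded factor; `P` is the pressure. -/
lemma exists_partitionFn_bounds (h : IsQuasiAdditive φ C M) {p : ℕ} (hp : GlueWithin X p) :
    ∃ P Q : ℝ, ∀ n : ℕ, Real.exp (n * P - Q) ≤ partitionFn φ n ∧
      partitionFn φ n ≤ Real.exp (n * P + Q) := by
  obtain ⟨B, hB⟩ := h.exists_bound p
  set L := Real.log (Real.exp (3 * C + 3 * M + 2 * B + p) * Real.exp (C + 2 * M) *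
    partitionFn φ p) with hL
  have hZ : ∀ n, 0 < partitionFn φ n := partitionFn_pos
  obtain ⟨P, hP⟩ := exists_abs_sub_linear_le (a := fun n => Real.log (partitionFn φ n))
    (K := |C + 2 * M| + |L|) (by
      intro n m
      have h1 := Real.log_le_log (hZ _) (partitionFn_add_le h n m)
      have h2 := Real.log_le_log (mul_pos (hZ n) (hZ m)) (le_partitionFn_add h hp hB n m)
      have hpp := hZ p
      rw [Real.log_mul (Real.exp_ne_zero _) (mul_pos (hZ n) (hZ m)).ne', Real.log_exp,
        Real.log_mul (hZ n).ne' (hZ m).ne'] at h1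
      rw [Real.log_mul (hZ n).ne' (hZ m).ne', Real.log_mul (by positivity) (hZ _).ne', ← hL] at h2
      rw [abs_le]
      constructor <;> linarith [le_abs_self (C + 2 * M), le_abs_self L, abs_nonneg L,
        abs_nonneg (C + 2 * M)])
  refine ⟨P, |C + 2 * M| + |L|, fun n => ?_⟩
  have := abs_le.mp (hP n)
  rw [← Real.le_log_iff_exp_le (hZ n), ← Real.log_le_iff_le_exp (hZ n)]
  constructor <;> linarith

end Partition

/-! ### Existence of an invariant Gibbs measure -/

section Existence

variable {k : ℕ} {X : Subshift (Fin k) ℕ}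

/-- The Gibbs bounds in exponential form, for a measure that need not be invariant. -/
def GibbsBounds (φ : ℕ → X.carrier → ℝ) (P K : ℝ) (ν : Measure X.carrier) : Prop :=
  ∀ (n : ℕ) (x : X.carrier),
    Real.exp (φ n x - n * P - K) ≤ ν.real (pre X n ⁻¹' {pre X n x}) ∧
      ν.real (pre X n ⁻¹' {pre X n x}) ≤ Real.exp (φ n x - n * P + K)

/-- Weak-* compactness, in the form that measures of clopen sets converge along a filter. -/
lemma exists_limit_measure (μs : ℕ → Measure X.carrier) (hμs : ∀ N, IsProbabilityMeasure (μs N)) :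
    ∃ (F : Filter ℕ) (μ : Measure X.carrier), F.NeBot ∧ F ≤ atTop ∧ IsProbabilityMeasure μ ∧
      ∀ A : Set X.carrier, IsClopen A → Tendsto (fun N => (μs N).real A) F (𝓝 (μ.real A)) := by
  let ps : ℕ → ProbabilityMeasure X.carrier := fun N => ⟨μs N, hμs N⟩
  let U : Ultrafilter ℕ := Ultrafilter.of atTop
  obtain ⟨μ, -, hμ⟩ := (isCompact_univ (X := ProbabilityMeasure X.carrier)).ultrafilter_le_nhds
    (U.map ps) (by simp)
  refine ⟨U, (μ : Measure X.carrier), U.neBot, Ultrafilter.of_le _, inferInstance, fun A hA => ?_⟩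
  have ht : Tendsto ps U (𝓝 μ) := hμ
  have h := ProbabilityMeasure.tendsto_measure_of_null_frontier_of_tendsto' ht (E := A)
    (by rw [hA.frontier_eq, measure_empty])
  exact (ENNReal.tendsto_toReal (measure_ne_top _ _)).comp h

section Approx

variable [Nonempty X.carrier] {φ : ℕ → X.carrier → ℝ} {C M : ℝ}

/-- The discrete measure that gives mass proportional to its weight to a representative of each
word of length `N`. -/
def approxGibbs (φ : ℕ → X.carrier → ℝ) (N : ℕ) : Measure X.carrier :=
  ∑ w ∈ words X N, ENNReal.ofReal (wt φ N w / partitionFn φ N) • Measure.dirac (rep X N w)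

open Classical in
lemma approxGibbs_apply (N : ℕ) {A : Set X.carrier} (hA : MeasurableSet A) :
    approxGibbs φ N A =
      ENNReal.ofReal ((∑ w ∈ words X N with rep X N w ∈ A, wt φ N w) / partitionFn φ N) := by
  have h0 : ∀ w, 0 ≤ wt φ N w / partitionFn φ N :=
    fun w => div_nonneg (wt_pos N w).le (partitionFn_pos N).le
  rw [approxGibbs, Measure.finsetSum_apply, Finset.sum_div, ENNReal.ofReal_sum_of_nonneg
    fun w _ => h0 w, Finset.sum_filter]
  refine Finset.sum_congr rfl fun w _ => ?_
  rw [Measure.smul_apply, Measure.dirac_apply' _ hA, smul_eq_mul]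
  by_cases h : rep X N w ∈ A <;> simp [h]

instance (N : ℕ) : IsProbabilityMeasure (approxGibbs φ N) := by
  classical
  refine ⟨?_⟩
  rw [approxGibbs_apply N MeasurableSet.univ]
  simp only [Set.mem_univ, Finset.filter_true]
  change ENNReal.ofReal (partitionFn φ N / partitionFn φ N) = 1
  rw [div_self (partitionFn_pos N).ne', ENNReal.ofReal_one]

lemma approxGibbs_real_cylinder (n m : ℕ) (x : X.carrier) :
    (approxGibbs φ (n + m)).real (pre X n ⁻¹' {pre X n x}) =
      (∑ w ∈ extensions n m x, wt φ (n + m) w) / partitionFn φ (n + m) := by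
  classical
  rw [measureReal_def, approxGibbs_apply _ ((isClopen_pre n _).isOpen.measurableSet),
    ENNReal.toReal_ofReal]
  · congr 1
    refine Finset.sum_congr ?_ fun _ _ => rfl
    ext w
    simp [extensions]
  · exact div_nonneg (Finset.sum_nonneg fun _ _ => (wt_pos _ _).le) (partitionFn_pos _).le

/-- A weak-* limit of the measures `approxGibbs φ N` is a Gibbs measure. -/
lemma exists_gibbsBounds (h : IsQuasiAdditive φ C M) {p : ℕ} (hp : GlueWithin X p) :
    ∃ (P K : ℝ) (ν : Measure X.carrier), IsProbabilityMeasure ν ∧ GibbsBounds φ P K ν := by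
  obtain ⟨P, Q, hPQ⟩ := exists_partitionFn_bounds h hp
  obtain ⟨B, hB⟩ := h.exists_bound p
  obtain ⟨F, ν, hF, hF', hν, hlim⟩ := exists_limit_measure (approxGibbs φ) inferInstance
  set K1 := 3 * C + 3 * M + 2 * B + p with hK1
  refine ⟨P, max (C + 2 * M + 2 * Q) (K1 + 2 * Q + p * P), ν, hν, fun n x => ?_⟩
  have ht := hlim _ (isClopen_pre n {pre X n x})
  have hup : ∀ m, (approxGibbs φ (n + m)).real (pre X n ⁻¹' {pre X n x}) ≤
      Real.exp (φ n x - n * P + (C + 2 * M + 2 * Q)) := by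
    intro m
    rw [approxGibbs_real_cylinder, div_le_iff₀ (partitionFn_pos _)]
    calc _ ≤ Real.exp (φ n x + (C + 2 * M)) * partitionFn φ m := sum_extensions_le h n m x
      _ ≤ Real.exp (φ n x + (C + 2 * M)) * Real.exp (m * P + Q) := by
          gcongr; exact (hPQ m).2
      _ = Real.exp (φ n x - n * P + (C + 2 * M + 2 * Q)) *
          Real.exp (((n + m : ℕ) : ℝ) * P - Q) := by
          rw [← Real.exp_add, ← Real.exp_add]
          push_cast
          congr 1
          ring
      _ ≤ _ := by gcongr; exact (hPQ _).1
  have hlow : ∀ m, Real.exp (φ n x - n * P - (K1 + 2 * Q + p * P)) ≤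
      (approxGibbs φ (n + (m + p))).real (pre X n ⁻¹' {pre X n x}) := by
    intro m
    rw [approxGibbs_real_cylinder, le_div_iff₀ (partitionFn_pos _)]
    have h1 := le_sum_extensions h hp hB n m x
    rw [← hK1] at h1
    refine le_of_mul_le_mul_left (le_trans ?_ h1) (Real.exp_pos K1)
    calc Real.exp K1 * (Real.exp (φ n x - n * P - (K1 + 2 * Q + p * P)) *
          partitionFn φ (n + (m + p)))
        ≤ Real.exp K1 * (Real.exp (φ n x - n * P - (K1 + 2 * Q + p * P)) *
          Real.exp (((n + (m + p) : ℕ) : ℝ) * P + Q)) := by gcongr; exact (hPQ _).2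
      _ = Real.exp (φ n x) * Real.exp (m * P - Q) := by
          rw [← Real.exp_add, ← Real.exp_add, ← Real.exp_add]
          push_cast
          congr 1
          ring
      _ ≤ _ := by gcongr; exact (hPQ m).1
  constructor
  · refine ge_of_tendsto ht (hF' ?_)
    filter_upwards [eventually_ge_atTop (n + p)] with N hN
    obtain ⟨m, rfl⟩ := Nat.exists_eq_add_of_le hN
    rw [show n + p + m = n + (m + p) by ring]
    refine le_trans (Real.exp_le_exp.mpr ?_) (hlow m)
    have := le_max_right (C + 2 * M + 2 * Q) (K1 + 2 * Q + p * P)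
    linarith
  · refine le_of_tendsto ht (hF' ?_)
    filter_upwards [eventually_ge_atTop n] with N hN
    obtain ⟨m, rfl⟩ := Nat.exists_eq_add_of_le hN
    refine (hup m).trans (Real.exp_le_exp.mpr ?_)
    have := le_max_left (C + 2 * M + 2 * Q) (K1 + 2 * Q + p * P)
    linarith

end Approx

/-! ### Quasi-independence of cylinders under Gibbs measures -/

section Joint

variable {φ : ℕ → X.carrier → ℝ} {C M P K : ℝ} {ν : Measure X.carrier} [IsProbabilityMeasure ν]

lemma measurable_pre_sigma (n j : ℕ) : Measurable fun x => pre X n ((sigma X)^[j] x) :=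
  (measurable_pre n).comp (measurable_sigma.iterate j)

/-- Under a Gibbs measure, events depending on the first `i` symbols and on the next `n` symbols are
independent up to a bounded factor from above. -/
lemma GibbsBounds.joint_le (hν : GibbsBounds φ P K ν) (h : IsQuasiAdditive φ C M) (i n : ℕ)
    (S : Set (Fin i → Fin k)) (T : Set (Fin n → Fin k)) :
    ν.real (pre X i ⁻¹' S ∩ (fun x => pre X n ((sigma X)^[i] x)) ⁻¹' T) ≤
      Real.exp (C + 3 * K) * (ν.real (pre X i ⁻¹' S) * ν.real (pre X n ⁻¹' T)) := by
  classical
  rw [← Set.coe_toFinset S, ← Set.coe_toFinset T,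
    ← sum_joint (measurable_pre i) (measurable_pre_sigma n i),
    measureReal_preimage_eq_sum (measurable_pre i), measureReal_preimage_eq_sum (measurable_pre n),
    Finset.sum_mul_sum, Finset.mul_sum]
  simp_rw [Finset.mul_sum]
  refine Finset.sum_le_sum fun u _ => Finset.sum_le_sum fun v _ => ?_
  by_cases hne : ∃ z, (pre X i z, pre X n ((sigma X)^[i] z)) = (u, v)
  · obtain ⟨z, hz⟩ := hne
    obtain ⟨rfl, rfl⟩ := Prod.mk.inj hz
    have h1 := (hν i z).1
    have h2 := (hν n ((sigma X)^[i] z)).1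
    have h3 := (hν (i + n) z).2
    have h4 := abs_le.mp (h.abs_add_le i n z)
    calc ν.real ((fun x => (pre X i x, pre X n ((sigma X)^[i] x))) ⁻¹'
          {(pre X i z, pre X n ((sigma X)^[i] z))})
        ≤ ν.real (pre X (i + n) ⁻¹' {pre X (i + n) z}) := by
          refine measureReal_mono fun y hy => ?_
          obtain ⟨hy1, hy2⟩ := Prod.mk.inj hy
          exact pre_add_eq hy1 hy2
      _ ≤ Real.exp (φ (i + n) z - (i + n : ℕ) * P + K) := h3
      _ ≤ Real.exp (C + 3 * K) * (Real.exp (φ i z - i * P - K) *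
          Real.exp (φ n ((sigma X)^[i] z) - n * P - K)) := by
          rw [← Real.exp_add, ← Real.exp_add, Real.exp_le_exp]
          push_cast
          linarith
      _ ≤ _ := by gcongr
  · have : (fun x => (pre X i x, pre X n ((sigma X)^[i] x))) ⁻¹' {(u, v)} = ∅ := by
      ext z
      simpa using fun h1 h2 => hne ⟨z, by rw [h1, h2]⟩
    rw [this, measureReal_empty]
    positivity

/-- The lower bound matching `GibbsBounds.joint_le`. The gap supplied by weak specification depends
on the words, so only the sum over all gaps of length at most `p` is bounded below. -/
lemma GibbsBounds.le_joint (hν : GibbsBounds φ P K ν) (h : IsQuasiAdditive φ C M) {p : ℕ}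
    (hp : GlueWithin X p) :
    ∃ D : ℝ, 0 < D ∧ ∀ (i n : ℕ) (S : Set (Fin i → Fin k)) (T : Set (Fin n → Fin k)),
      ν.real (pre X i ⁻¹' S) * ν.real (pre X n ⁻¹' T) ≤ D * ∑ l ∈ Finset.range (p + 1),
        ν.real (pre X i ⁻¹' S ∩ (fun x => pre X n ((sigma X)^[i + l] x)) ⁻¹' T) := by
  classical
  obtain ⟨B, hB⟩ := h.exists_bound p
  refine ⟨Real.exp (2 * C + 2 * M + B + 3 * K + p * |P|), Real.exp_pos _, fun i n S T => ?_⟩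
  rw [← Set.coe_toFinset S, ← Set.coe_toFinset T,
    measureReal_preimage_eq_sum (measurable_pre i), measureReal_preimage_eq_sum (measurable_pre n),
    Finset.sum_mul_sum]
  simp_rw [← sum_joint (measurable_pre i) (measurable_pre_sigma n (i + _))]
  rw [Finset.sum_comm (s := Finset.range (p + 1)), Finset.mul_sum]
  refine Finset.sum_le_sum fun u _ => ?_
  rw [Finset.sum_comm (s := Finset.range (p + 1)), Finset.mul_sum]
  refine Finset.sum_le_sum fun v _ => ?_
  have hnn : ∀ l ∈ Finset.range (p + 1), 0 ≤
      ν.real ((fun x => (pre X i x, pre X n ((sigma X)^[i + l] x))) ⁻¹' {(u, v)}) :=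
    fun _ _ => measureReal_nonneg
  by_cases hu : ∃ x, pre X i x = u
  swap
  · have : pre X i ⁻¹' {u} = ∅ := by
      ext x; simpa using fun hx => hu ⟨x, hx⟩
    rw [this, measureReal_empty, zero_mul]
    exact mul_nonneg (Real.exp_pos _).le (Finset.sum_nonneg hnn)
  by_cases hv : ∃ y, pre X n y = v
  swap
  · have : pre X n ⁻¹' {v} = ∅ := by
      ext x; simpa using fun hx => hv ⟨x, hx⟩
    rw [this, measureReal_empty, mul_zero]
    exact mul_nonneg (Real.exp_pos _).le (Finset.sum_nonneg hnn)
  obtain ⟨x, rfl⟩ := hu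
  obtain ⟨y, rfl⟩ := hv
  obtain ⟨l, hl, z, hz1, hz2⟩ := hp i n x y
  have h1 := (hν i x).2
  have h2 := (hν n y).2
  have h3 := (hν (i + l + n) z).1
  have h4 := abs_le.mp (h.abs_glue_le hB hl hz1 hz2)
  have h5 : (l : ℝ) * P ≤ p * |P| :=
    (mul_le_mul_of_nonneg_left (le_abs_self P) (Nat.cast_nonneg l)).trans
      (mul_le_mul_of_nonneg_right (Nat.cast_le.mpr hl) (abs_nonneg P))
  calc ν.real (pre X i ⁻¹' {pre X i x}) * ν.real (pre X n ⁻¹' {pre X n y})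
      ≤ Real.exp (φ i x - i * P + K) * Real.exp (φ n y - n * P + K) := by gcongr
    _ ≤ Real.exp (2 * C + 2 * M + B + 3 * K + p * |P|) *
        Real.exp (φ (i + l + n) z - (i + l + n : ℕ) * P - K) := by
        rw [← Real.exp_add, ← Real.exp_add, Real.exp_le_exp]
        push_cast
        linarith
    _ ≤ Real.exp (2 * C + 2 * M + B + 3 * K + p * |P|) *
        ν.real ((fun x => (pre X i x, pre X n ((sigma X)^[i + l] x))) ⁻¹'
          {(pre X i x, pre X n y)}) := by
        gcongr
        refine h3.trans (measureReal_mono fun w hw => ?_)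
        have hw : pre X (i + l + n) w = pre X (i + l + n) z := hw
        simp only [Set.mem_preimage, Set.mem_singleton_iff, Prod.mk.injEq]
        exact ⟨(pre_eq_of_le (by omega) hw).trans hz1, (pre_sigma_eq hw).trans hz2⟩
    _ ≤ _ := by
        gcongr
        exact Finset.single_le_sum hnn (Finset.mem_range.mpr (by omega))

end Joint

/-! ### Cesàro averages of a measure along the shift -/

section Cesaro

variable {ν : Measure X.carrier}

/-- The average of the images of `ν` under the first `N + 1` iterates of the shift. -/
def cesaro (ν : Measure X.carrier) (N : ℕ) : Measure X.carrier :=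
  ((N + 1 : ℕ) : ENNReal)⁻¹ • ∑ j ∈ Finset.range (N + 1), ν.map ((sigma X)^[j])

lemma cesaro_apply (N : ℕ) {A : Set X.carrier} (hA : MeasurableSet A) :
    cesaro ν N A = ((N + 1 : ℕ) : ENNReal)⁻¹ *
      ∑ j ∈ Finset.range (N + 1), ν ((sigma X)^[j] ⁻¹' A) := by
  rw [cesaro, Measure.smul_apply, Measure.finsetSum_apply, smul_eq_mul]
  congr 1
  exact Finset.sum_congr rfl fun j _ => Measure.map_apply (measurable_sigma.iterate j) hA

variable [IsProbabilityMeasure ν]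

instance (N : ℕ) : IsProbabilityMeasure (cesaro ν N) := by
  refine ⟨?_⟩
  rw [cesaro_apply N MeasurableSet.univ]
  simp only [Set.preimage_univ, measure_univ, Finset.sum_const, Finset.card_range, nsmul_eq_mul,
    mul_one]
  exact ENNReal.inv_mul_cancel (by simp) (ENNReal.natCast_ne_top _)

lemma cesaro_real (N : ℕ) {A : Set X.carrier} (hA : MeasurableSet A) :
    (cesaro ν N).real A = (∑ j ∈ Finset.range (N + 1), ν.real ((sigma X)^[j] ⁻¹' A)) / (N + 1) := by
  rw [measureReal_def, cesaro_apply N hA, ENNReal.toReal_mul,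
    ENNReal.toReal_sum fun _ _ => measure_ne_top _ _, ENNReal.toReal_inv, ENNReal.toReal_natCast]
  push_cast
  rw [div_eq_inv_mul]
  rfl

end Cesaro

end Existence

/-! ### Invariance and ergodicity -/

section Invariant

variable {k : ℕ} {X : Subshift (Fin k) ℕ} {φ : ℕ → X.carrier → ℝ} {C M : ℝ}

/-- Any weak-* limit of the Cesàro averages of a Gibbs measure is invariant and still Gibbs: the
upper bound survives for each translate, the lower bound for the sum of `p + 1` consecutive
translates. -/
lemma exists_invariant_gibbsBounds [Nonempty X.carrier] (h : IsQuasiAdditive φ C M) {p : ℕ}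
    (hp : GlueWithin X p) :
    ∃ (P K : ℝ) (μ : Measure X.carrier), μ ∈ invariantMeasures X ∧ GibbsBounds φ P K μ := by
  obtain ⟨P, K, ν, hν, hG⟩ := exists_gibbsBounds h hp
  obtain ⟨D, hD, hlow⟩ := hG.le_joint h hp
  obtain ⟨F, μ, hF, hF', hμ, hlim⟩ := exists_limit_measure (cesaro ν) inferInstance
  -- the bounds for translates of a cylinder, from quasi-independence with the whole space
  have hup : ∀ j n (T : Set (Fin n → Fin k)), ν.real ((sigma X)^[j] ⁻¹' (pre X n ⁻¹' T)) ≤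
      Real.exp (C + 3 * K) * ν.real (pre X n ⁻¹' T) := by
    intro j n T
    have := hG.joint_le h j n Set.univ T
    simp only [Set.preimage_univ, Set.univ_inter, probReal_univ, one_mul] at this
    exact this
  have hlow' : ∀ j n (T : Set (Fin n → Fin k)), ν.real (pre X n ⁻¹' T) ≤
      D * ∑ l ∈ Finset.range (p + 1), ν.real ((sigma X)^[j + l] ⁻¹' (pre X n ⁻¹' T)) := by
    intro j n T
    have := hlow j n Set.univ T
    simp only [Set.preimage_univ, Set.univ_inter, probReal_univ, one_mul] at this
    exact this
  have hμup : ∀ n (T : Set (Fin n → Fin k)), μ.real (pre X n ⁻¹' T) ≤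
      Real.exp (C + 3 * K) * ν.real (pre X n ⁻¹' T) := by
    intro n T
    have hA := isClopen_pre (X := X) n T
    refine le_of_tendsto (hlim _ hA) (Eventually.of_forall fun N => ?_)
    rw [cesaro_real N hA.isOpen.measurableSet, div_le_iff₀ (by positivity)]
    refine (Finset.sum_le_sum fun j _ => hup j n T).trans (le_of_eq ?_)
    simp only [Finset.sum_const, Finset.card_range, nsmul_eq_mul]
    push_cast
    ring
  have hμlow : ∀ n (T : Set (Fin n → Fin k)), ν.real (pre X n ⁻¹' T) ≤
      D * (p + 1) * μ.real (pre X n ⁻¹' T) := by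
    intro n T
    have hA := isClopen_pre (X := X) n T
    have hN : Tendsto (fun N : ℕ => (p : ℝ) / (N + 1)) F (𝓝 0) :=
      ((tendsto_const_div_atTop_nhds_zero_nat (p : ℝ)).comp (tendsto_add_atTop_nat 1)).mono_left
        hF' |>.congr fun N => by simp
    have ht := ((hlim _ hA).add hN).const_mul (D * (p + 1))
    rw [add_zero] at ht
    refine ge_of_tendsto ht (Eventually.of_forall fun N => ?_)
    rw [cesaro_real N hA.isOpen.measurableSet, ← add_div, ← mul_div_assoc,
      le_div_iff₀ (by positivity)]
    set a : ℕ → ℝ := fun j => ν.real ((sigma X)^[j] ⁻¹' (pre X n ⁻¹' T)) with ha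
    have ha1 : ∀ j, a j ≤ 1 := fun j => measureReal_le_one
    have ha0 : ∀ j, 0 ≤ a j := fun j => measureReal_nonneg
    -- shifting the window of summation by `l ≤ p` changes the sum by at most `p`
    have hshift : ∀ l ∈ Finset.range (p + 1), ∑ j ∈ Finset.range (N + 1), a (j + l) ≤
        ∑ j ∈ Finset.range (N + 1), a j + p := by
      intro l hl
      rw [Finset.mem_range] at hl
      have h1 : ∑ j ∈ Finset.range (N + 1), a (j + l) ≤ ∑ j ∈ Finset.range (l + (N + 1)), a j := by
        rw [Finset.sum_range_add a l (N + 1)]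
        simp only [add_comm _ l]
        exact le_add_of_nonneg_left (Finset.sum_nonneg fun j _ => ha0 j)
      have h2 : ∑ j ∈ Finset.range l, a (N + 1 + j) ≤ p := by
        refine (Finset.sum_le_sum fun j _ => ha1 _).trans ?_
        simpa using (by omega : l ≤ p)
      rw [add_comm l, Finset.sum_range_add a (N + 1) l] at h1
      linarith
    calc ν.real (pre X n ⁻¹' T) * (N + 1)
        = ∑ j ∈ Finset.range (N + 1), ν.real (pre X n ⁻¹' T) := by
          simp [mul_comm]
      _ ≤ ∑ j ∈ Finset.range (N + 1), D * ∑ l ∈ Finset.range (p + 1), a (j + l) :=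
          Finset.sum_le_sum fun j _ => hlow' j n T
      _ = D * ∑ l ∈ Finset.range (p + 1), ∑ j ∈ Finset.range (N + 1), a (j + l) := by
          rw [← Finset.mul_sum, Finset.sum_comm]
      _ ≤ D * ∑ l ∈ Finset.range (p + 1), (∑ j ∈ Finset.range (N + 1), a j + p) := by
          gcongr with l hl
          exact hshift l hl
      _ = D * (p + 1) * (∑ j ∈ Finset.range (N + 1), a j + p) := by
          rw [Finset.sum_const, Finset.card_range, nsmul_eq_mul]
          push_cast
          ring
  have hinv : ∀ n (T : Set (Fin n → Fin k)),
      μ.real (sigma X ⁻¹' (pre X n ⁻¹' T)) = μ.real (pre X n ⁻¹' T) := by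
    intro n T
    have hA := isClopen_pre (X := X) n T
    have hA' := hA.preimage continuous_sigma
    have ht := (hlim _ hA').sub (hlim _ hA)
    have h0 : Tendsto (fun N => (cesaro ν N).real (sigma X ⁻¹' (pre X n ⁻¹' T)) -
        (cesaro ν N).real (pre X n ⁻¹' T)) F (𝓝 0) := by
      have hN : Tendsto (fun N : ℕ => (1 : ℝ) / (N + 1)) F (𝓝 0) :=
        (tendsto_one_div_add_atTop_nhds_zero_nat (𝕜 := ℝ)).mono_left hF'
      refine squeeze_zero_norm (fun N => ?_) hN
      rw [cesaro_real N hA.isOpen.measurableSet, cesaro_real N hA'.isOpen.measurableSet, ← sub_div,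
        norm_div, Real.norm_of_nonneg (by positivity : (0 : ℝ) ≤ (N : ℝ) + 1)]
      refine div_le_div_of_nonneg_right ?_ (by positivity)
      set a : ℕ → ℝ := fun j => ν.real ((sigma X)^[j] ⁻¹' (pre X n ⁻¹' T)) with ha
      have h1 : ∀ j, ν.real ((sigma X)^[j] ⁻¹' (sigma X ⁻¹' (pre X n ⁻¹' T))) = a (j + 1) := by
        intro j
        change _ = ν.real ((sigma X)^[j + 1] ⁻¹' (pre X n ⁻¹' T))
        rw [Function.iterate_succ', Set.preimage_comp]
      simp_rw [h1]
      rw [← Finset.sum_sub_distrib, Finset.sum_range_sub, Real.norm_eq_abs, abs_le]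
      have ha1 : ∀ j, a j ≤ 1 := fun j => measureReal_le_one
      have ha0 : ∀ j, 0 ≤ a j := fun j => measureReal_nonneg
      constructor <;> linarith [ha1 0, ha0 0, ha1 (N + 1), ha0 (N + 1)]
    exact sub_eq_zero.mp (tendsto_nhds_unique ht h0)
  refine ⟨P, max (C + 4 * K) (K + Real.log (D * (p + 1))), μ, ⟨hμ, measurable_sigma, ?_⟩,
    fun n x => ⟨?_, ?_⟩⟩
  · have : IsProbabilityMeasure (μ.map (sigma X)) :=
      Measure.isProbabilityMeasure_map measurable_sigma.aemeasurable
    refine measure_ext_pre fun n T => ?_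
    rw [Measure.map_apply measurable_sigma (isClopen_pre n T).isOpen.measurableSet]
    exact (measureReal_eq_measureReal_iff).mp (hinv n T)
  · have hD' : 0 < D * (p + 1) := by positivity
    refine le_of_mul_le_mul_left (le_trans ?_ (hμlow n _)) hD'
    refine le_trans ?_ (hG n x).1
    rw [← Real.exp_log hD', ← Real.exp_add, Real.exp_le_exp, Real.exp_log hD']
    linarith [le_max_right (C + 4 * K) (K + Real.log (D * (p + 1)))]
  · refine (hμup n _).trans ((mul_le_mul_of_nonneg_left (hG n x).2 (Real.exp_pos _).le).trans ?_)
    rw [← Real.exp_add, Real.exp_le_exp]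
    linarith [le_max_left (C + 4 * K) (K + Real.log (D * (p + 1)))]

open scoped symmDiff in
/-- Quasi-independence of cylinders forces an invariant Gibbs measure to be ergodic: an invariant
set `E` and its complement would otherwise be approximated by unions of cylinders, some translates
of which overlap too much. -/
lemma GibbsBounds.ergodic (h : IsQuasiAdditive φ C M) {p : ℕ} (hp : GlueWithin X p) {P K : ℝ}
    {μ : Measure X.carrier} (hμ : μ ∈ invariantMeasures X) (hG : GibbsBounds φ P K μ) :
    Ergodic (sigma X) μ := by
  obtain ⟨hprob, hinv⟩ := hμ
  obtain ⟨D, hD, hlow⟩ := hG.le_joint h hp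
  refine ⟨hinv, ⟨fun E hE hEinv => ?_⟩⟩
  have hiter : ∀ j, (sigma X)^[j] ⁻¹' E = E := fun j => by
    rw [Set.preimage_iterate_eq]
    exact Function.iterate_fixed hEinv j
  have key : ∀ ε : ℝ, 0 < ε → ε ≤ 1 →
      μ.real E * μ.real Eᶜ ≤ (2 * D * (p + 1) + 3) * ε := by
    intro ε hε hε1
    obtain ⟨n, S, hS⟩ := exists_cylinder_approx μ hE hε
    set A := pre X n ⁻¹' S with hA
    have hAm : MeasurableSet A := (isClopen_pre n S).isOpen.measurableSet
    have hAE : μ.real (A \ E) ≤ ε := (measureReal_mono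
      (by rw [Set.symmDiff_def]; exact Set.subset_union_left)).trans hS.le
    have hEA : μ.real (E \ A) ≤ ε := (measureReal_mono
      (by rw [Set.symmDiff_def]; exact Set.subset_union_right)).trans hS.le
    have h1 := hlow n n S Sᶜ
    have h2 : ∀ l ∈ Finset.range (p + 1),
        μ.real (A ∩ (fun x => pre X n ((sigma X)^[n + l] x)) ⁻¹' Sᶜ) ≤ 2 * ε := by
      intro l _
      have hsub : A ∩ (fun x => pre X n ((sigma X)^[n + l] x)) ⁻¹' Sᶜ ⊆
          (A \ E) ∪ (sigma X)^[n + l] ⁻¹' (E \ A) := by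
        rintro x ⟨hx1, hx2⟩
        by_cases hx : x ∈ E
        · refine Or.inr ⟨?_, hx2⟩
          have : x ∈ (sigma X)^[n + l] ⁻¹' E := by rwa [hiter]
          exact this
        · exact Or.inl ⟨hx1, hx⟩
      refine (measureReal_mono hsub).trans ((measureReal_union_le _ _).trans ?_)
      rw [(hinv.iterate (n + l)).measureReal_preimage (hE.diff hAm).nullMeasurableSet]
      linarith
    have h3 := Finset.sum_le_sum h2
    rw [Finset.sum_const, Finset.card_range, nsmul_eq_mul] at h3
    push_cast at h3
    have h4 : μ.real A * μ.real Aᶜ ≤ D * ((p + 1) * (2 * ε)) :=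
      h1.trans (mul_le_mul_of_nonneg_left h3 hD.le)
    have h5 : μ.real E ≤ μ.real A + ε := by
      have := measureReal_mono (μ := μ) (show E ⊆ A ∪ (E \ A) by simp)
      linarith [measureReal_union_le (μ := μ) A (E \ A)]
    have h6 : μ.real Eᶜ ≤ μ.real Aᶜ + ε := by
      have hsub : Eᶜ ⊆ Aᶜ ∪ (A \ E) := by
        intro x hx
        by_cases hxA : x ∈ A
        · exact Or.inr ⟨hxA, hx⟩
        · exact Or.inl hxA
      have := measureReal_mono (μ := μ) hsub
      linarith [measureReal_union_le (μ := μ) Aᶜ (A \ E)]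
    have ha1 : μ.real A ≤ 1 := measureReal_le_one
    have ha2 : μ.real Aᶜ ≤ 1 := measureReal_le_one
    calc μ.real E * μ.real Eᶜ ≤ (μ.real A + ε) * (μ.real Aᶜ + ε) := by gcongr
      _ = μ.real A * μ.real Aᶜ + (μ.real A + μ.real Aᶜ + ε) * ε := by ring
      _ ≤ D * ((p + 1) * (2 * ε)) + 3 * ε := by
          gcongr
          linarith
      _ = _ := by ring
  have hzero : μ.real E * μ.real Eᶜ ≤ 0 := by
    have ht : Tendsto (fun ε : ℝ => (2 * D * (p + 1) + 3) * ε) (𝓝[>] 0) (𝓝 0) := by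
      have : Tendsto (fun ε : ℝ => (2 * D * (p + 1) + 3) * ε) (𝓝 0)
          (𝓝 ((2 * D * (p + 1) + 3) * 0)) := tendsto_id.const_mul _
      rw [mul_zero] at this
      exact this.mono_left nhdsWithin_le_nhds
    refine ge_of_tendsto ht ?_
    filter_upwards [Ioc_mem_nhdsGT (zero_lt_one' ℝ)] with ε hε
    exact key ε hε.1 hε.2
  rw [eventuallyConst_set']
  rcases mul_eq_zero.mp (le_antisymm hzero (mul_nonneg measureReal_nonneg measureReal_nonneg))
    with h0 | h0
  · left
    exact ae_eq_empty.mpr ((measureReal_eq_zero_iff).mp h0)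
  · right
    exact ae_eq_univ.mpr ((measureReal_eq_zero_iff).mp h0)

end Invariant

/-! ### Relative entropy and uniqueness of the equilibrium state -/

section Variational

variable {k : ℕ} {X : Subshift (Fin k) ℕ}

/-- Relative entropy of `m` with respect to `μ` on the partition into words of length `n`. -/
def relEntropy (m μ : Measure X.carrier) (n : ℕ) : ℝ :=
  ∑ w, m.real (pre X n ⁻¹' {w}) *
    (Real.log (m.real (pre X n ⁻¹' {w})) - Real.log (μ.real (pre X n ⁻¹' {w})))

lemma relEntropy_self (m : Measure X.carrier) (n : ℕ) : relEntropy m m n = 0 := by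
  simp [relEntropy]

lemma relEntropy_eq (m μ : Measure X.carrier) [IsProbabilityMeasure m] (n : ℕ) :
    relEntropy m μ n = -shannon m (pre X n) -
      ∫ x, Real.log (μ.real (pre X n ⁻¹' {pre X n x})) ∂m := by
  have h : ∫ x, Real.log (μ.real (pre X n ⁻¹' {pre X n x})) ∂m =
      ∑ w, m.real (pre X n ⁻¹' {w}) * Real.log (μ.real (pre X n ⁻¹' {w})) := by
    have : IsProbabilityMeasure (m.map (pre X n)) :=
      Measure.isProbabilityMeasure_map (measurable_pre n).aemeasurable
    rw [← integral_map (f := fun w => Real.log (μ.real (pre X n ⁻¹' {w})))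
      (measurable_pre n).aemeasurable (measurable_of_finite _).aestronglyMeasurable,
      integral_fintype (Integrable.of_finite)]
    refine Finset.sum_congr rfl fun w _ => ?_
    rw [map_measureReal_apply (measurable_pre n) (measurableSet_singleton w), smul_eq_mul]
  rw [h, relEntropy, shannon]
  simp only [Real.negMulLog, neg_mul, Finset.sum_neg_distrib, neg_neg, mul_sub,
    Finset.sum_sub_distrib]

/-- A lower bound for relative entropy, linear in the two measures: the tangent line inequality
`a log (a / b) ≥ a (L + 1) - b e^L`, with slope `L` on the words in `S` and `0` elsewhere. -/
lemma le_relEntropy {m μ : Measure X.carrier} [IsProbabilityMeasure m] [IsProbabilityMeasure μ]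
    {n : ℕ} (hμ : ∀ x, 0 < μ.real (pre X n ⁻¹' {pre X n x})) (S : Set (Fin n → Fin k)) (L : ℝ) :
    L * m.real (pre X n ⁻¹' S) - Real.exp L * μ.real (pre X n ⁻¹' S) ≤ relEntropy m μ n := by
  classical
  set a : (Fin n → Fin k) → ℝ := fun w => m.real (pre X n ⁻¹' {w}) with ha
  set b : (Fin n → Fin k) → ℝ := fun w => μ.real (pre X n ⁻¹' {w}) with hb
  have ha0 : ∀ w, 0 ≤ a w := fun w => measureReal_nonneg
  have hb0 : ∀ w, 0 ≤ b w := fun w => measureReal_nonneg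
  have htan : ∀ w (l : ℝ), a w * (l + 1) - b w * Real.exp l ≤
      a w * (Real.log (a w) - Real.log (b w)) := by
    intro w l
    rcases (ha0 w).eq_or_lt with h0 | h0
    · rw [← h0]
      have := mul_nonneg (hb0 w) (Real.exp_pos l).le
      linarith
    · have hbw : 0 < b w := by
        obtain ⟨x, hx⟩ : (pre X n ⁻¹' {w}).Nonempty := by
          by_contra hne
          rw [Set.not_nonempty_iff_eq_empty] at hne
          simp [ha, hne] at h0
        have := hμ x
        rw [show pre X n x = w from hx] at this
        exact this
      have h1 := Real.log_le_sub_one_of_pos (x := b w * Real.exp l / a w) (by positivity)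
      rw [Real.log_div (by positivity) h0.ne', Real.log_mul hbw.ne' (Real.exp_ne_zero _),
        Real.log_exp] at h1
      have h2 := mul_le_mul_of_nonneg_left h1 h0.le
      have h3 : a w * (b w * Real.exp l / a w - 1) = b w * Real.exp l - a w := by field_simp
      rw [h3] at h2
      linarith
  have hsum : ∑ w, (a w * ((if w ∈ S then L else 0) + 1) -
      b w * Real.exp (if w ∈ S then L else 0)) ≤ relEntropy m μ n :=
    Finset.sum_le_sum fun w _ => htan w _
  have hsplit : ∀ w, a w * (if w ∈ S then L else 0) + (a w - b w) -
      (if w ∈ S then b w else 0) * Real.exp L ≤ a w * ((if w ∈ S then L else 0) + 1) -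
      b w * Real.exp (if w ∈ S then L else 0) := by
    intro w
    split_ifs with hw
    · linarith [hb0 w]
    · simp
  have h1 := (Finset.sum_le_sum fun w (_ : w ∈ Finset.univ) => hsplit w).trans hsum
  have e1 : ∑ w, a w = 1 := by
    rw [← measureReal_preimage_eq_sum (measurable_pre n)]; simp
  have e2 : ∑ w, b w = 1 := by
    rw [← measureReal_preimage_eq_sum (measurable_pre n)]; simp
  have e3 : ∑ w, a w * (if w ∈ S then L else 0) = L * m.real (pre X n ⁻¹' S) := by
    have := measureReal_preimage_eq_sum (m := m) (measurable_pre (X := X) n) S.toFinset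
    rw [Set.coe_toFinset] at this
    rw [this, Finset.mul_sum]
    simp only [mul_ite, mul_zero]
    rw [← Finset.sum_filter]
    refine Finset.sum_congr (by ext; simp) fun w _ => mul_comm _ _
  have e4 : ∑ w, (if w ∈ S then b w else 0) = μ.real (pre X n ⁻¹' S) := by
    have := measureReal_preimage_eq_sum (m := μ) (measurable_pre (X := X) n) S.toFinset
    rw [Set.coe_toFinset] at this
    rw [this, ← Finset.sum_filter]
    exact Finset.sum_congr (by ext; simp) fun w _ => rfl
  rw [Finset.sum_sub_distrib, Finset.sum_add_distrib, Finset.sum_sub_distrib, ← Finset.sum_mul,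
    e1, e2, e3, e4] at h1
  linarith

lemma relEntropy_nonneg {m μ : Measure X.carrier} [IsProbabilityMeasure m] [IsProbabilityMeasure μ]
    {n : ℕ} (hμ : ∀ x, 0 < μ.real (pre X n ⁻¹' {pre X n x})) : 0 ≤ relEntropy m μ n := by
  simpa using le_relEntropy (m := m) hμ ∅ 0

open scoped symmDiff in
/-- Bounded relative entropy on all word partitions implies absolute continuity. -/
lemma absolutelyContinuous_of_relEntropy_le {m μ : Measure X.carrier} [IsProbabilityMeasure m]
    [IsProbabilityMeasure μ] {K : ℝ}
    (hμ : ∀ n, 1 ≤ n → ∀ x, 0 < μ.real (pre X n ⁻¹' {pre X n x}))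
    (hK : ∀ n, 1 ≤ n → relEntropy m μ n ≤ K) : m ≪ μ := by
  refine Measure.AbsolutelyContinuous.mk fun E hE hE0 => ?_
  by_contra hne
  have hδ : 0 < m.real E := measureReal_nonneg.lt_of_ne'
    fun h => hne ((measureReal_eq_zero_iff).mp h)
  set δ := m.real E with hδdef
  have hμE : μ.real E = 0 := (measureReal_eq_zero_iff).mpr hE0
  -- a slope that makes `L δ / 2 - 1` exceed the bound
  set L := 2 * (|K| + 2) / δ with hL
  have hL0 : 0 < L := by positivity
  set ε := min (δ / 2) (Real.exp (-L)) with hε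
  have hε0 : 0 < ε := lt_min (by positivity) (Real.exp_pos _)
  obtain ⟨n, S, hS⟩ := exists_cylinder_approx (m + μ) hE hε0
  obtain ⟨T, hT⟩ := exists_pre_preimage_eq (X := X) (Nat.le_succ n) S
  rw [hT, measureReal_add_apply] at hS
  have h1 : δ ≤ m.real (pre X (n + 1) ⁻¹' T) + δ / 2 := by
    have := measureReal_mono (μ := m) (show E ⊆ pre X (n + 1) ⁻¹' T ∪ (pre X (n + 1) ⁻¹' T) ∆ E by
      intro x hx
      by_cases hxA : x ∈ pre X (n + 1) ⁻¹' T
      · exact Or.inl hxA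
      · exact Or.inr (Or.inr ⟨hx, hxA⟩))
    have h2 := measureReal_union_le (μ := m) (pre X (n + 1) ⁻¹' T) ((pre X (n + 1) ⁻¹' T) ∆ E)
    have h3 : 0 ≤ μ.real ((pre X (n + 1) ⁻¹' T) ∆ E) := measureReal_nonneg
    have h4 : ε ≤ δ / 2 := min_le_left _ _
    simp only [Nat.succ_eq_add_one] at hS
    linarith
  have h2 : μ.real (pre X (n + 1) ⁻¹' T) ≤ Real.exp (-L) := by
    have := measureReal_mono (μ := μ) (show pre X (n + 1) ⁻¹' T ⊆ E ∪ (pre X (n + 1) ⁻¹' T) ∆ E by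
      intro x hx
      by_cases hxE : x ∈ E
      · exact Or.inl hxE
      · exact Or.inr (Or.inl ⟨hx, hxE⟩))
    have h2 := measureReal_union_le (μ := μ) E ((pre X (n + 1) ⁻¹' T) ∆ E)
    have h3 : 0 ≤ m.real ((pre X (n + 1) ⁻¹' T) ∆ E) := measureReal_nonneg
    have h4 : ε ≤ Real.exp (-L) := min_le_right _ _
    simp only [Nat.succ_eq_add_one] at hS
    linarith
  have h3 := (le_relEntropy (m := m) (hμ (n + 1) (by omega)) T L).trans (hK (n + 1) (by omega))
  have h4 : Real.exp L * μ.real (pre X (n + 1) ⁻¹' T) ≤ 1 := by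
    refine (mul_le_mul_of_nonneg_left h2 (Real.exp_pos L).le).trans (le_of_eq ?_)
    rw [← Real.exp_add, add_neg_cancel, Real.exp_zero]
  have h5 : L * (δ / 2) ≤ L * m.real (pre X (n + 1) ⁻¹' T) := by
    gcongr
    linarith
  have h6 : L * (δ / 2) = |K| + 2 := by
    rw [hL]
    field_simp
  linarith [le_abs_self K]

variable {f : ℕ → X.carrier → ℝ} {g : X.carrier → ℝ} {C : ℝ}

/-- The Gibbs property on a logarithmic scale. -/
lemma exists_log_gibbs {μ : Measure X.carrier} (hμ : μ ∈ invariantGibbs f)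
    (hpos : ∀ n, 1 ≤ n → ∀ x, 0 < f n x) :
    ∃ P K : ℝ, ∀ n : ℕ, 1 ≤ n → ∀ x, 0 < μ.real (pre X n ⁻¹' {pre X n x}) ∧
      |Real.log (μ.real (pre X n ⁻¹' {pre X n x})) - (Real.log (f n x) - n * P)| ≤ K := by
  obtain ⟨-, P, D, hD, h⟩ := hμ
  refine ⟨P, Real.log D, fun n hn x => ?_⟩
  have hfx := hpos n hn x
  have h1 := (h n hn x).1
  have h2 := (h n hn x).2
  rw [cyl_eq] at h1 h2
  have hE : 0 < Real.exp (-n * P) * f n x := by positivity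
  have hq := (one_div_pos.mpr hD).trans_le h1
  have ht : 0 < μ.real (pre X n ⁻¹' {pre X n x}) := (div_pos_iff_of_pos_right hE).mp hq
  refine ⟨ht, ?_⟩
  have l1 := Real.log_le_log (one_div_pos.mpr hD) h1
  have l2 := Real.log_le_log hq h2
  rw [Real.log_div ht.ne' hE.ne', Real.log_mul (Real.exp_ne_zero _) hfx.ne', Real.log_exp]
    at l1 l2
  rw [one_div, Real.log_inv] at l1
  rw [abs_le]
  constructor <;> linarith

/-- Up to a bounded error, the relative entropy with respect to a Gibbs measure is the deficit in
the variational principle. -/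
lemma exists_relEntropy_bound {μ : Measure X.carrier} (hμ : μ ∈ invariantGibbs f)
    (hcont : ∀ n, 1 ≤ n → Continuous (f n)) (hpos : ∀ n, 1 ≤ n → ∀ x, 0 < f n x)
    (hg : Measurable g) (hgb : ∃ B, ∀ x, |g x| ≤ B)
    (hfg : ∀ n, 1 ≤ n → ∀ x, |Real.log (f n x) - birkhoffSum (sigma X) g n x| ≤ C) :
    (∀ n, 1 ≤ n → ∀ x, 0 < μ.real (pre X n ⁻¹' {pre X n x})) ∧
    ∃ P K : ℝ, ∀ m ∈ invariantMeasures X, ∀ n : ℕ, 1 ≤ n →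
      |relEntropy m μ n - (n * (P - ∫ x, g x ∂m) - shannon m (pre X n))| ≤ K := by
  obtain ⟨P, K, h⟩ := exists_log_gibbs hμ hpos
  refine ⟨fun n hn x => (h n hn x).1, P, K + C, fun m hm n hn => ?_⟩
  obtain ⟨hm1, hm2⟩ := hm
  obtain ⟨B, hB⟩ := hgb
  have hint : Integrable g m :=
    Integrable.of_bound hg.aestronglyMeasurable B (Eventually.of_forall hB)
  have h1 := abs_integral_log_sub_le hm2 hg hint (hcont n hn) (hpos n hn) (hfg n hn)
  have hi1 : Integrable (fun x => Real.log (f n x)) m := by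
    obtain ⟨B, hB⟩ := exists_log_bound (hcont n hn) (hpos n hn)
    exact Integrable.of_bound ((hcont n hn).log fun x => (hpos n hn x).ne').aestronglyMeasurable B
      (Eventually.of_forall hB)
  have hi2 : Integrable (fun x => Real.log (μ.real (pre X n ⁻¹' {pre X n x}))) m := by
    have : Integrable (fun w => Real.log (μ.real (pre X n ⁻¹' {w}))) (m.map (pre X n)) := by
      have : IsProbabilityMeasure (m.map (pre X n)) :=
        Measure.isProbabilityMeasure_map (measurable_pre n).aemeasurable
      exact Integrable.of_finite
    exact this.comp_measurable (measurable_pre n)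
  have h2 := norm_integral_le_of_norm_le_const (μ := m)
    (f := fun x => Real.log (μ.real (pre X n ⁻¹' {pre X n x})) - (Real.log (f n x) - n * P))
    (C := K) (Eventually.of_forall fun x => (h n hn x).2)
  have hi3 : Integrable (fun x => Real.log (f n x) - n * P) m := hi1.sub (integrable_const _)
  rw [integral_sub hi2 hi3, integral_sub hi1 (integrable_const _)] at h2
  simp only [integral_const, probReal_univ, smul_eq_mul, one_mul, mul_one, Real.norm_eq_abs] at h2
  rw [relEntropy_eq]
  rw [abs_le] at *
  constructor <;> linarith [h1.1, h1.2, h2.1, h2.2]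

/-- The variational principle: every invariant Gibbs measure is an equilibrium state, and an
ergodic one is the only equilibrium state. -/
lemma equilibrium_of_gibbs {μ : Measure X.carrier} (hμ : μ ∈ invariantGibbs f)
    (hcont : ∀ n, 1 ≤ n → Continuous (f n)) (hpos : ∀ n, 1 ≤ n → ∀ x, 0 < f n x)
    (hg : Measurable g) (hgb : ∃ B, ∀ x, |g x| ≤ B)
    (hfg : ∀ n, 1 ≤ n → ∀ x, |Real.log (f n x) - birkhoffSum (sigma X) g n x| ≤ C) :
    μ ∈ equilibriumStatesFun g ∧
      (Ergodic (sigma X) μ → ∀ m ∈ equilibriumStatesFun g, m = μ) := by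
  obtain ⟨hμpos, P, K, hrel⟩ := exists_relEntropy_bound hμ hcont hpos hg hgb hfg
  have hμprob : IsProbabilityMeasure μ := hμ.1.1
  have hle : ∀ m ∈ invariantMeasures X, ∀ h : ℝ,
      Tendsto (fun n : ℕ => shannon m (pre X n) / n) atTop (𝓝 h) → h + ∫ x, g x ∂m ≤ P := by
    intro m hm h hh
    have hmprob : IsProbabilityMeasure m := hm.1
    have ht := (tendsto_const_div_atTop_nhds_zero_nat K).const_add (P - ∫ x, g x ∂m)
    rw [add_zero] at ht
    have := le_of_tendsto_of_tendsto hh ht (by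
      filter_upwards [eventually_ge_atTop 1] with n hn
      have hn' : (0 : ℝ) < n := by exact_mod_cast hn
      rw [div_le_iff₀ hn', add_mul, div_mul_cancel₀ _ hn'.ne']
      have h1 := abs_le.mp (hrel m hm n hn)
      have h2 := relEntropy_nonneg (m := m) (hμpos n hn)
      linarith)
    linarith
  have hge : ∀ h : ℝ, Tendsto (fun n : ℕ => shannon μ (pre X n) / n) atTop (𝓝 h) →
      P ≤ h + ∫ x, g x ∂μ := by
    intro h hh
    have ht := (tendsto_const_div_atTop_nhds_zero_nat K).const_sub (P - ∫ x, g x ∂μ)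
    rw [sub_zero] at ht
    have := le_of_tendsto_of_tendsto ht hh (by
      filter_upwards [eventually_ge_atTop 1] with n hn
      have hn' : (0 : ℝ) < n := by exact_mod_cast hn
      rw [le_div_iff₀ hn', sub_mul, div_mul_cancel₀ _ hn'.ne']
      have h1 := abs_le.mp (hrel μ hμ.1 n hn)
      rw [relEntropy_self] at h1
      linarith)
    linarith
  have hsup_le : ∀ m ∈ invariantMeasures X,
      entropy (sigma X) m + ((∫ x, g x ∂m : ℝ) : EReal) ≤ (P : EReal) := by
    intro m hm
    have hmprob : IsProbabilityMeasure m := hm.1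
    obtain ⟨h, hent, -, hlim⟩ := exists_entropy_eq hm.2
    rw [hent, ← EReal.coe_add, EReal.coe_le_coe_iff]
    exact hle m hm h hlim
  have hμeq : entropy (sigma X) μ + ((∫ x, g x ∂μ : ℝ) : EReal) = (P : EReal) := by
    obtain ⟨h, hent, -, hlim⟩ := exists_entropy_eq hμ.1.2
    rw [hent, ← EReal.coe_add]
    exact congrArg _ (le_antisymm (hle μ hμ.1 h hlim) (hge h hlim))
  have hsup : (⨆ m ∈ invariantMeasures X,
      (entropy (sigma X) m + ((∫ x, g x ∂m : ℝ) : EReal))) = (P : EReal) :=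
    le_antisymm (iSup₂_le hsup_le) (hμeq ▸ le_iSup₂ (f := fun m (_ : m ∈ invariantMeasures X) =>
      entropy (sigma X) m + ((∫ x, g x ∂m : ℝ) : EReal)) μ hμ.1)
  refine ⟨⟨hμ.1, by rw [hsup, hμeq]⟩, fun herg m hm => ?_⟩
  obtain ⟨hminv, hmeq⟩ := hm
  have hmprob : IsProbabilityMeasure m := hminv.1
  obtain ⟨h, hent, hmul, -⟩ := exists_entropy_eq hminv.2
  rw [hsup, hent, ← EReal.coe_add, EReal.coe_eq_coe_iff] at hmeq
  refine herg.eq_of_absolutelyContinuous hminv.2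
    (absolutelyContinuous_of_relEntropy_le hμpos (K := K) fun n hn => ?_)
  have h1 := abs_le.mp (hrel m hminv n hn)
  have h2 := hmul n
  rw [← hmeq] at h1
  have h3 : (n : ℝ) * (h + ∫ x, g x ∂m - ∫ x, g x ∂m) = n * h := by ring
  rw [h3] at h1
  linarith

end Variational

/-! ### Almost additive sequences of bounded variation -/

section AlmostAdditive

variable {k : ℕ} {X : Subshift (Fin k) ℕ} {f : ℕ → X.carrier → ℝ}

/-- The sequence `log f_n`, with value `0` at the index `0`, where `f` is unconstrained. -/
def logSeq (f : ℕ → X.carrier → ℝ) (n : ℕ) (x : X.carrier) : ℝ :=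
  if n = 0 then 0 else Real.log (f n x)

lemma logSeq_of_pos {n : ℕ} (hn : 1 ≤ n) (x : X.carrier) : logSeq f n x = Real.log (f n x) :=
  if_neg (by omega)

lemma isQuasiAdditive_logSeq {C M : ℝ} (hC : 0 < C)
    (hcont : ∀ n, 1 ≤ n → Continuous (f n)) (hpos : ∀ n, 1 ≤ n → ∀ x, 0 < f n x)
    (hadd : ∀ n m : ℕ, 1 ≤ n → 1 ≤ m → ∀ x, AdditiveUpTo f C n m x)
    (hM : ∀ n, 1 ≤ n → ∀ x y : X.carrier, y ∈ cyl X n x → f n x / f n y ≤ M) :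
    IsQuasiAdditive (logSeq f) C |Real.log M| where
  zero x := if_pos rfl
  abs_add_le n m x := by
    rcases Nat.eq_zero_or_pos n with rfl | hn
    · simpa [logSeq] using hC.le
    rcases Nat.eq_zero_or_pos m with rfl | hm
    · simpa [logSeq] using hC.le
    rw [logSeq_of_pos hn, logSeq_of_pos hm, logSeq_of_pos (by omega)]
    exact (hadd n m hn hm x).abs_log_sub_le (hpos n hn x) (hpos m hm _) (hpos _ (by omega) x)
  var_le n x y hxy := by
    rcases Nat.eq_zero_or_pos n with rfl | hn
    · simp [logSeq]
    rw [logSeq_of_pos hn, logSeq_of_pos hn, ← Real.log_div (hpos n hn x).ne' (hpos n hn y).ne']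
    exact (Real.log_le_log (div_pos (hpos n hn x) (hpos n hn y))
      (hM n hn x y (mem_cyl_iff.mpr hxy.symm))).trans (le_abs_self _)
  bdd n := by
    rcases Nat.eq_zero_or_pos n with rfl | hn
    · exact ⟨0, fun x => by simp [logSeq]⟩
    obtain ⟨B, hB⟩ := exists_log_bound (hcont n hn) (hpos n hn)
    exact ⟨B, fun x => by rw [logSeq_of_pos hn]; exact hB x⟩

lemma mem_invariantGibbs_of_gibbsBounds {P K : ℝ} {μ : Measure X.carrier}
    (hpos : ∀ n, 1 ≤ n → ∀ x, 0 < f n x) (hμ : μ ∈ invariantMeasures X)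
    (hG : GibbsBounds (logSeq f) P K μ) : μ ∈ invariantGibbs f := by
  refine ⟨hμ, P, Real.exp K, Real.exp_pos K, fun n hn x => ?_⟩
  have hexp : Real.exp (-n * P) * f n x = Real.exp (logSeq f n x - n * P) := by
    rw [logSeq_of_pos hn, sub_eq_add_neg, Real.exp_add, Real.exp_log (hpos n hn x), neg_mul,
      mul_comm]
  rw [cyl_eq, hexp]
  constructor
  · rw [le_div_iff₀ (Real.exp_pos _), one_div, ← Real.exp_neg, ← Real.exp_add]
    refine le_trans (le_of_eq ?_) (hG n x).1
    ring_nf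
  · rw [div_le_iff₀ (Real.exp_pos _), ← Real.exp_add]
    refine (hG n x).2.trans (le_of_eq ?_)
    ring_nf

/-- Existence and uniqueness of the equilibrium state, which is also the unique invariant Gibbs
measure. -/
lemma exists_unique_equilibrium_gibbs (hne : X.carrier.Nonempty) (hspec : HasWeakSpecification X)
    {C : ℝ} (hC : 0 < C)
    (hcont : ∀ n, 1 ≤ n → Continuous (f n)) (hpos : ∀ n, 1 ≤ n → ∀ x, 0 < f n x)
    (hadd : ∀ n m : ℕ, 1 ≤ n → 1 ≤ m → ∀ x, AdditiveUpTo f C n m x)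
    (hbv : HasBoundedVariation f) {g : X.carrier → ℝ} (hg : Measurable g)
    (hgb : ∃ B, ∀ x, |g x| ≤ B)
    (hfg : ∀ n, 1 ≤ n → ∀ x, |Real.log (f n x) - birkhoffSum (sigma X) g n x| ≤ C) :
    ∃ μ : Measure X.carrier, equilibriumStatesFun g = {μ} ∧ invariantGibbs f = {μ} := by
  have : Nonempty X.carrier := hne.to_subtype
  obtain ⟨M, hM⟩ := hbv
  obtain ⟨p, hp⟩ := hspec.exists_glueWithin
  have hq := isQuasiAdditive_logSeq hC hcont hpos hadd hM
  obtain ⟨P, K, μ, hμ, hG⟩ := exists_invariant_gibbsBounds hq hp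
  have herg := hG.ergodic hq hp hμ
  have hμG := mem_invariantGibbs_of_gibbsBounds hpos hμ hG
  obtain ⟨heq, huniq⟩ := equilibrium_of_gibbs hμG hcont hpos hg hgb hfg
  refine ⟨μ, Set.Subset.antisymm (huniq herg) (by simpa using heq),
    Set.Subset.antisymm (fun m hm => ?_) (by simpa using hμG)⟩
  exact huniq herg m (equilibrium_of_gibbs hm hcont hpos hg hgb hfg).1

lemma log_expSum (g : X.carrier → ℝ) (n : ℕ) (x : X.carrier) :
    Real.log (expSum g n x) = birkhoffSum (sigma X) g n x := Real.log_exp _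

end AlmostAdditive

end

end NonadditiveGibbs


theorem theorem3p2 (k : ℕ) (X : SymbolicDynamics.FullShift.Subshift (Fin k) ℕ)
    (hne : X.carrier.Nonempty) (hspec : HasWeakSpecification X)
    (f : ℕ → X.carrier → ℝ)
    (hcont : ∀ n, 1 ≤ n → Continuous (f n))
    (hpos : ∀ n, 1 ≤ n → ∀ x, 0 < f n x)
    (hlim : ∀ x, lowerRatio f x = upperRatio f x) :
    (IsAlmostAdditive f →
      (∀ x, Tendsto (fun n : ℕ => Real.log (f (n + 1) x / f n (sigma X x))) atTop
        (𝓝 (hatF f x))) ∧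
      IsBoundedBorelApprox f (hatF f) ∧
      (HasBoundedVariation f →
        ∃ μ : Measure X.carrier,
          equilibriumStates f = {μ} ∧ invariantGibbs f = {μ} ∧
          equilibriumStatesFun (hatF f) = {μ} ∧ invariantGibbs (expSum (hatF f)) = {μ})) ∧
    (IsWeaklyAlmostAdditive f →
      (∀ x, Tendsto (fun n : ℕ => Real.log (f (n + 1) x / f n (sigma X x))) atTop
        (𝓝 (hatF f x))) ∧
      IsBoundedBorelApprox f (hatF f) ∧
      ∀ μ ∈ equilibriumStates f, μ ∈ invariantGibbs f →
        μ ∈ equilibriumStatesFun (hatF f) ∧ μ ∈ invariantWeakGibbs (expSum (hatF f))) := by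
  obtain ⟨B, hB⟩ := exists_log_bound (hcont 1 le_rfl) (hpos 1 le_rfl)
  have hexp : ∀ n, 1 ≤ n → ∀ x, 0 < expSum (hatF f) n x := fun _ _ _ => Real.exp_pos _
  -- the common part of both claims
  have main : ∀ C : ℕ → ℝ, Tendsto (fun n : ℕ => C n / n) atTop (𝓝 0) →
      (∀ n m : ℕ, 1 ≤ n → 1 ≤ m → ∀ x, AdditiveUpTo f (C n) n m x) →
      (∀ x, Tendsto (fun n : ℕ => Real.log (f (n + 1) x / f n (sigma X x))) atTop
        (𝓝 (hatF f x))) ∧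
      IsBoundedBorelApprox f (hatF f) ∧
      ∀ n, 1 ≤ n → ∀ x, |Real.log (f n x) - Real.log (expSum (hatF f) n x)| ≤ C n := by
    intro C hC hadd
    have ht := tendsto_hatF hpos (fun m hm => hadd 1 m le_rfl hm) hB hlim
    have habs : ∀ n, 1 ≤ n → ∀ x,
        |Real.log (f n x) - birkhoffSum (sigma X) (hatF f) n x| ≤ C n :=
      fun n hn => abs_log_sub_birkhoffSum_le hpos ht hn fun m hm => hadd n m hn hm
    exact ⟨ht, isBoundedBorelApprox_of_abs_le (measurable_hatF hcont ht)
      (abs_hatF_le hpos (fun m hm => hadd 1 m le_rfl hm) hB hlim) hcont hpos hC habs,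
      fun n hn x => by rw [log_expSum]; exact habs n hn x⟩
  constructor
  · rintro ⟨C, hC, hadd⟩
    obtain ⟨ht, happrox, habs⟩ := main (fun _ => C) (tendsto_const_div_atTop_nhds_zero_nat C) hadd
    refine ⟨ht, happrox, fun hbv => ?_⟩
    obtain ⟨μ, h1, h2⟩ := exists_unique_equilibrium_gibbs hne hspec hC hcont hpos hadd hbv
      happrox.2.1 happrox.1 fun n hn x => by rw [← log_expSum]; exact habs n hn x
    refine ⟨μ, (equilibriumStates_eq_of_isBoundedBorelApprox happrox).trans h1, h2, h1, ?_⟩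
    rw [← h2]
    exact Set.Subset.antisymm (invariantGibbs_subset_of_abs_log_le hexp hpos fun n hn x => by
      rw [abs_sub_comm]; exact habs n hn x) (invariantGibbs_subset_of_abs_log_le hpos hexp habs)
  · rintro ⟨C, -, hC, hadd⟩
    obtain ⟨ht, happrox, habs⟩ := main C hC hadd
    refine ⟨ht, happrox, fun μ hμ hμG => ⟨?_, ?_⟩⟩
    · rwa [← equilibriumStates_eq_of_isBoundedBorelApprox happrox]
    · exact mem_invariantWeakGibbs_of_abs_log_le hpos hexp hC habs hμG
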